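/- A topological drawing of $K_m$ places the vertices at distinct points of the plane and draws each edge as a simple curve connecting its two end-vertices and containing no other vertex, such that any two edges have at most one common point, which is a common vertex or a crossing (not a touching), and no three edges cross in a single point. A face of a drawing is a connected component of its complement in the plane. A triangle is the subdrawing induced by three vertices; it is a simple closed curve, and its two sides (one bounded, one unbounded) are the closures of the connected components of its complement. A side is convex if every edge with both end-vertices in the side is completely drawn in the side. A drawing is face-convex if there is a face $f_\infty$ such that, for every triangle, the side not containing $f_\infty$ is convex. The Helly number of a family of sets with empty intersection is the size of its smallest subfamily with empty intersection. Helly's theorem does not generalize to face-convex drawings: it is not true that, for every face-convex drawing of a complete graph and every finite set of its triangles, if the bounded sides of any at most three of these triangles have a common point, then the bounded sides of all of them have a common point. Moreover, for every integer $n\ge 3$ there exists a face-convex drawing $D$ of $K_{3n}$ with $n$ distinct triangles such that the bounded sides of any $n-1$ of these triangles have a common interior point, but the intersection of the bounded sides of all $n$ triangles is empty; in particular, the Helly number of the family of these $n$ bounded sides is at least $n$. The drawing $D$ can be chosen to be a straight-line drawing with one of its faces $f_o$ made the outer face, i.e., there are a topological drawing $D_0$ of $K_{3n}$ all of whose edges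 are straight-line segments, a face $f_o$ of $D_0$, and a homeomorphism of the sphere (the one-point compactification of the plane) that maps $D_0$ to $D$ and maps a point of $f_o$ to the point at infinity. -/

import Mathlib

open Set

/-- The Euclidean plane. -/
abbrev Plane : Type := EuclideanSpace ℝ (Fin 2)

/-- `A` is (the trace of) a simple curve connecting `a` and `b`. -/
def IsSimpleArc (a b : Plane) (A : Set Plane) : Prop :=
  ∃ γ : Path a b, Function.Injective γ ∧ Set.range γ = A

/-- `A` and `B` cross (and do not merely touch) at `p`: some local homeomorphism of the plane at `p`
straightens `A` and `B` to the two coordinate axes. -/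
def CrossAt (A B : Set Plane) (p : Plane) : Prop :=
  ∃ φ : OpenPartialHomeomorph Plane Plane, p ∈ φ.source ∧ φ p = 0 ∧
    ∀ x ∈ φ.source, (x ∈ A ↔ φ x 1 = 0) ∧ (x ∈ B ↔ φ x 0 = 0)

/-- A (simple) topological drawing, in the plane, of the complete graph with vertex set `V`.
The edge joining `u ≠ v` is drawn as the set `edge s(u, v)`; the values of `edge` on the
diagonal of `Sym2 V` carry no meaning and are never used. -/
structure TopologicalDrawing (V : Type) where
  vertex : V → Plane
  edge : Sym2 V → Set Plane
  /-- Vertices are mapped to distinct points. -/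
  vertex_injective : Function.Injective vertex
  /-- Edges are mapped to simple curves connecting the two corresponding vertices. -/
  edge_isSimpleArc : ∀ u v : V, u ≠ v → IsSimpleArc (vertex u) (vertex v) (edge s(u, v))
  /-- Edges contain no other vertices. -/
  mem_of_vertex_mem_edge : ∀ (e : Sym2 V) (w : V), ¬ e.IsDiag → vertex w ∈ edge e → w ∈ e
  /-- Two edges have at most one common point. -/
  edge_inter_subsingleton : ∀ e f : Sym2 V, ¬ e.IsDiag → ¬ f.IsDiag → e ≠ f →
    (edge e ∩ edge f).Subsingleton
  /-- A common point of two edges is a common vertex or a crossing. -/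
  vertex_or_crossAt : ∀ e f : Sym2 V, ¬ e.IsDiag → ¬ f.IsDiag → e ≠ f →
    ∀ p ∈ edge e ∩ edge f, (∃ v, v ∈ e ∧ v ∈ f ∧ vertex v = p) ∨ CrossAt (edge e) (edge f) p
  /-- No three edges cross in a single point. -/
  no_three_cross : ∀ e f g : Sym2 V, ¬ e.IsDiag → ¬ f.IsDiag → ¬ g.IsDiag →
    e ≠ f → e ≠ g → f ≠ g → ∀ p ∈ edge e ∩ edge f ∩ edge g, ∃ v, vertex v = p

namespace TopologicalDrawing

variable {V : Type} (D : TopologicalDrawing V)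

/-- The set of all points of the plane that lie on the drawing. -/
def support : Set Plane :=
  Set.range D.vertex ∪ ⋃ (e : Sym2 V) (_ : ¬ e.IsDiag), D.edge e

/-- `F` is a face (cell) of the drawing: a connected component of the complement of the drawing. -/
def IsFace (F : Set Plane) : Prop :=
  ∃ p ∈ D.supportᶜ, F = connectedComponentIn D.supportᶜ p

/-- The closed curve formed by the edges of the drawing between vertices of `t`; this is the
triangle spanned by `t` when `t` has three elements. -/
def triangle (t : Finset V) : Set Plane :=
  ⋃ (e : Sym2 V) (_ : ¬ e.IsDiag ∧ ∀ v ∈ e, v ∈ t), D.edge e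

/-- `S` is a side of the triangle `t`: the closure of a connected component of its complement. -/
def IsSide (t : Finset V) (S : Set Plane) : Prop :=
  ∃ p ∈ (D.triangle t)ᶜ, S = closure (connectedComponentIn (D.triangle t)ᶜ p)

/-- The bounded side of the triangle `t`: the closure of the (unique) bounded connected component
of its complement, given here as the set of all points whose component is bounded. -/
def boundedSide (t : Finset V) : Set Plane :=
  closure {p | p ∈ (D.triangle t)ᶜ ∧
    Bornology.IsBounded (connectedComponentIn (D.triangle t)ᶜ p)}

/-- A side is convex if every edge with both end-vertices in it is completely drawn in it. -/
def IsConvexSide (S : Set Plane) : Prop :=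
  ∀ u v : V, u ≠ v → D.vertex u ∈ S → D.vertex v ∈ S → D.edge s(u, v) ⊆ S

/-- There is a face `F` such that, for every triangle, the side not containing `F` is convex. -/
def IsFaceConvex : Prop :=
  ∃ F : Set Plane, D.IsFace F ∧
    ∀ t : Finset V, t.card = 3 → ∀ S : Set Plane, D.IsSide t S → ¬ F ⊆ S → D.IsConvexSide S

/-- All edges are straight-line segments. -/
def IsStraightLine : Prop :=
  ∀ u v : V, u ≠ v → D.edge s(u, v) = segment ℝ (D.vertex u) (D.vertex v)

/-- `D` is obtained from `D₀` by making the face `F` of `D₀` the outer face: some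
homeomorphism of the sphere (the one-point compactification of the plane) carries `D₀` to `D` and a
point of `F` to the point at infinity. -/
def IsObtainedByMakingOuter (D₀ : TopologicalDrawing V) (F : Set Plane) : Prop :=
  ∃ h : OnePoint Plane ≃ₜ OnePoint Plane,
    (∀ v : V, h (D₀.vertex v : OnePoint Plane) = (D.vertex v : OnePoint Plane)) ∧
    (∀ e : Sym2 V, ¬ e.IsDiag →
      h '' ((fun x : Plane => (x : OnePoint Plane)) '' D₀.edge e) =
        (fun x : Plane => (x : OnePoint Plane)) '' D.edge e) ∧
    ∃ p ∈ F, h (p : OnePoint Plane) = OnePoint.infty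

end TopologicalDrawing

/-- The Helly number of a family of sets: the size of its smallest (finite) subfamily with empty
intersection (`⊤` if there is none). -/
noncomputable def hellyNumber {ι X : Type} (S : ι → Set X) : ℕ∞ :=
  ⨅ (s : Finset ι) (_ : ⋂ i ∈ s, S i = ∅), (s.card : ℕ∞)

/-! The construction starts from a straight-line drawing on points in general position, none of
whose edges passes through the origin, and makes the face around the origin the outer face by
inversion in the unit circle. A triangle not containing the origin keeps its inside as bounded side,
whereas for a triangle around the origin the old outside, together with the old point at infinity,
becomes the bounded side (`boundedSide_of_zero_notMem`, `boundedSide_of_zero_mem`).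

Face-convexity is inherited from convexity of ordinary triangles. The distinguished face is the
image of the old unbounded face, so the side of a triangle that misses it is the image of the old
inside, and edges are images of segments (`isFaceConvex_invertedDrawing`).

It remains to find one flat triangle away from the origin and `n - 1` triangles around the origin
whose interiors cover the flat one, each of them being needed (`exists_configuration`). After
inversion, a common point of all bounded sides would be a point of the flat triangle outside all the
others, which the covering forbids. Dropping one covering triangle frees a point that only this
triangle covered; dropping the flat triangle frees the image of the point at infinity. The
incidences required are open conditions, and general position is generic by analyticity and Baire,
so an explicit configuration can be perturbed. -/

/-! ### Inversion of the plane and of the sphere. -/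

/-- Inversion of the plane in the unit circle, with the junk value `0` at the center `0`. -/
noncomputable def planeInv (x : Plane) : Plane := EuclideanGeometry.inversion 0 1 x

lemma planeInv_planeInv (x : Plane) : planeInv (planeInv x) = x :=
  EuclideanGeometry.inversion_inversion _ one_ne_zero x

lemma planeInv_involutive : Function.Involutive planeInv := planeInv_planeInv

lemma planeInv_injective : Function.Injective planeInv := planeInv_involutive.injective

@[simp] lemma planeInv_zero : planeInv 0 = 0 := EuclideanGeometry.inversion_self _ _

lemma planeInv_eq_zero {x : Plane} : planeInv x = 0 ↔ x = 0 :=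
  EuclideanGeometry.inversion_eq_center one_ne_zero

lemma norm_planeInv (x : Plane) : ‖planeInv x‖ = 1 / ‖x‖ := by
  simpa [planeInv] using EuclideanGeometry.dist_inversion_center 0 x 1

lemma mem_planeInv_image {x : Plane} {s : Set Plane} : x ∈ planeInv '' s ↔ planeInv x ∈ s := by
  rw [image_eq_preimage_of_inverse planeInv_planeInv planeInv_planeInv, mem_preimage]

lemma continuousAt_planeInv {x : Plane} (hx : x ≠ 0) : ContinuousAt planeInv x :=
  continuousAt_const.inversion continuousAt_const continuousAt_id hx

lemma continuousOn_planeInv {s : Set Plane} (hs : (0 : Plane) ∉ s) : ContinuousOn planeInv s :=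
  fun _ hx => (continuousAt_planeInv (fun h => hs (h ▸ hx))).continuousWithinAt

lemma tendsto_planeInv_nhdsNE_zero :
    Filter.Tendsto planeInv (nhdsWithin 0 {0}ᶜ) (Bornology.cobounded Plane) :=
  EuclideanGeometry.tendsto_inversion_nhdsNE_center_cobounded one_ne_zero

lemma tendsto_planeInv_cobounded :
    Filter.Tendsto planeInv (Bornology.cobounded Plane) (nhds 0) := by
  rw [tendsto_zero_iff_norm_tendsto_zero]
  simp only [norm_planeInv, one_div]
  exact tendsto_inv_atTop_zero.comp tendsto_norm_cobounded_atTop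

/-- Inversion as a local homeomorphism of the punctured plane. -/
noncomputable def planeInvHomeomorph : OpenPartialHomeomorph Plane Plane where
  toFun := planeInv
  invFun := planeInv
  source := {0}ᶜ
  target := {0}ᶜ
  map_source' _ hx := fun h => hx (planeInv_eq_zero.1 h)
  map_target' _ hx := fun h => hx (planeInv_eq_zero.1 h)
  left_inv' x _ := planeInv_planeInv x
  right_inv' x _ := planeInv_planeInv x
  open_source := isOpen_compl_singleton
  open_target := isOpen_compl_singleton
  continuousOn_toFun := continuousOn_planeInv (by simp)
  continuousOn_invFun := continuousOn_planeInv (by simp)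

lemma isOpen_planeInv_image {s : Set Plane} (hs : IsOpen s) (h0 : (0 : Plane) ∉ s) :
    IsOpen (planeInv '' s) :=
  planeInvHomeomorph.isOpen_image_of_subset_source hs (fun _ hx h => h0 (h ▸ hx))

open Classical in
/-- Inversion of the sphere, exchanging `0` and the point at infinity. -/
noncomputable def sphereInv : OnePoint Plane → OnePoint Plane
  | OnePoint.infty => ((0 : Plane) : OnePoint Plane)
  | OnePoint.some x => if x = 0 then OnePoint.infty else ((planeInv x : Plane) : OnePoint Plane)

lemma sphereInv_infty : sphereInv OnePoint.infty = ((0 : Plane) : OnePoint Plane) := rfl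

lemma sphereInv_zero : sphereInv ((0 : Plane) : OnePoint Plane) = OnePoint.infty := if_pos rfl

lemma sphereInv_coe {x : Plane} (hx : x ≠ 0) :
    sphereInv (x : OnePoint Plane) = ((planeInv x : Plane) : OnePoint Plane) := if_neg hx

lemma sphereInv_involutive : Function.Involutive sphereInv := by
  intro x
  induction x using OnePoint.rec with
  | infty => rw [sphereInv_infty, sphereInv_zero]
  | coe x =>
    by_cases hx : x = 0
    · rw [hx, sphereInv_zero, sphereInv_infty]
    · rw [sphereInv_coe hx, sphereInv_coe (mt planeInv_eq_zero.1 hx), planeInv_planeInv]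

lemma continuous_sphereInv : Continuous sphereInv := by
  rw [continuous_iff_continuousAt]
  intro x
  induction x using OnePoint.rec with
  | infty =>
    rw [OnePoint.continuousAt_infty', sphereInv_infty, Filter.coclosedCompact_eq_cocompact,
      ← Metric.cobounded_eq_cocompact]
    refine ((OnePoint.continuous_coe.tendsto 0).comp tendsto_planeInv_cobounded).congr' ?_
    filter_upwards [Bornology.eventually_ne_cobounded (0 : Plane)] with x hx
    exact (sphereInv_coe hx).symm
  | coe x =>
    rw [OnePoint.continuousAt_coe]
    by_cases hx : x = 0
    · subst hx
      rw [← continuousWithinAt_compl_self, ContinuousWithinAt, Function.comp_apply, sphereInv_zero]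
      have h := OnePoint.tendsto_coe_infty (X := Plane)
      rw [Filter.coclosedCompact_eq_cocompact, ← Metric.cobounded_eq_cocompact] at h
      refine (h.comp tendsto_planeInv_nhdsNE_zero).congr' ?_
      filter_upwards [self_mem_nhdsWithin] with x hx
      exact (sphereInv_coe hx).symm
    · refine ((OnePoint.continuous_coe.continuousAt).comp (continuousAt_planeInv hx)).congr ?_
      filter_upwards [isOpen_compl_singleton.mem_nhds hx] with y hy
      exact (sphereInv_coe hy).symm

/-- Inversion of the sphere as a homeomorphism. -/
noncomputable def sphereInvHomeomorph : OnePoint Plane ≃ₜ OnePoint Plane where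
  toEquiv := sphereInv_involutive.toPerm
  continuous_toFun := continuous_sphereInv
  continuous_invFun := continuous_sphereInv

/-! ### Inverting a topological drawing. -/

namespace TopologicalDrawing

variable {V : Type}

lemma vertex_mem_support (D : TopologicalDrawing V) (v : V) : D.vertex v ∈ D.support :=
  Or.inl (mem_range_self v)

lemma edge_subset_support (D : TopologicalDrawing V) {e : Sym2 V} (he : ¬ e.IsDiag) :
    D.edge e ⊆ D.support :=
  fun _ hx => Or.inr (mem_biUnion he hx)

/-- The image of a drawing that avoids the origin under inversion. -/
noncomputable def inverted (D : TopologicalDrawing V) (h0 : (0 : Plane) ∉ D.support) :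
    TopologicalDrawing V where
  vertex v := planeInv (D.vertex v)
  edge e := planeInv '' D.edge e
  vertex_injective := planeInv_injective.comp D.vertex_injective
  edge_isSimpleArc u v huv := by
    obtain ⟨γ, hγ, hr⟩ := D.edge_isSimpleArc u v huv
    have hc : ContinuousOn planeInv (range γ) := continuousOn_planeInv
      fun h => h0 (D.edge_subset_support (by simpa using huv) (hr ▸ h))
    refine ⟨γ.map' hc, planeInv_injective.comp hγ, ?_⟩
    rw [← hr, ← range_comp]
    rfl
  mem_of_vertex_mem_edge e w he hw :=
    D.mem_of_vertex_mem_edge e w he (planeInv_injective.mem_set_image.1 hw)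
  edge_inter_subsingleton e f he hf hef := by
    rw [← image_inter planeInv_injective]
    exact (D.edge_inter_subsingleton e f he hf hef).image _
  vertex_or_crossAt e f he hf hef p hp := by
    rw [← image_inter planeInv_injective] at hp
    obtain ⟨q, hq, rfl⟩ := hp
    have hq0 : q ≠ 0 := fun h => h0 (h ▸ D.edge_subset_support he hq.1)
    refine (D.vertex_or_crossAt e f he hf hef q hq).imp
      (fun ⟨v, hve, hvf, hv⟩ => ⟨v, hve, hvf, congrArg planeInv hv⟩) ?_
    rintro ⟨φ, hqs, hφ, h⟩
    -- Inversion is its own inverse, so a straightening chart at `q` precomposed with it straightens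
    -- the images at `planeInv q`.
    refine ⟨planeInvHomeomorph.trans φ, ?_, ?_, fun x hx => ?_⟩
    · rw [OpenPartialHomeomorph.trans_source]
      refine ⟨mt planeInv_eq_zero.1 hq0, ?_⟩
      change planeInv (planeInv q) ∈ φ.source
      rwa [planeInv_planeInv]
    · change φ (planeInv (planeInv q)) = 0
      rwa [planeInv_planeInv]
    · rw [OpenPartialHomeomorph.trans_source] at hx
      rw [mem_planeInv_image, mem_planeInv_image]
      exact h (planeInv x) hx.2
  no_three_cross e f g he hf hg hef heg hfg p hp := by
    rw [← image_inter planeInv_injective, ← image_inter planeInv_injective] at hp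
    obtain ⟨q, hq, rfl⟩ := hp
    exact (D.no_three_cross e f g he hf hg hef heg hfg q hq).imp fun v hv => congrArg planeInv hv

lemma support_inverted (D : TopologicalDrawing V) (h0 : (0 : Plane) ∉ D.support) :
    (D.inverted h0).support = planeInv '' D.support := by
  simp only [support, inverted, image_union, image_iUnion, ← range_comp]
  rfl

lemma triangle_inverted (D : TopologicalDrawing V) (h0 : (0 : Plane) ∉ D.support) (t : Finset V) :
    (D.inverted h0).triangle t = planeInv '' D.triangle t := by
  simp only [triangle, inverted, image_iUnion]

lemma triangle_subset_support (D : TopologicalDrawing V) (t : Finset V) :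
    D.triangle t ⊆ D.support :=
  iUnion₂_subset fun _ he => D.edge_subset_support he.1

/-- The spherical inversion sends the origin to infinity and agrees with `planeInv` on the drawing,
which avoids the origin. -/
lemma isObtainedByMakingOuter_inverted (D : TopologicalDrawing V) (h0 : (0 : Plane) ∉ D.support) :
    (D.inverted h0).IsObtainedByMakingOuter D (connectedComponentIn D.supportᶜ 0) := by
  have key : ∀ x ∈ D.support, sphereInvHomeomorph (x : OnePoint Plane) = planeInv x :=
    fun x hx => sphereInv_coe fun h => h0 (h ▸ hx)
  refine ⟨sphereInvHomeomorph, fun v => key _ (D.vertex_mem_support v), fun e he => ?_, 0,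
    mem_connectedComponentIn h0, sphereInv_zero⟩
  change _ = _ '' (planeInv '' _)
  rw [image_image, image_image]
  exact image_congr fun x hx => key x (D.edge_subset_support he hx)

end TopologicalDrawing

/-! ### Determinants, lines and segments. -/

lemma Plane.ext {x y : Plane} (h0 : x 0 = y 0) (h1 : x 1 = y 1) : x = y := by
  ext i; fin_cases i <;> assumption

/-- The cross product of two vectors of the plane. -/
def cross (x y : Plane) : ℝ := x 0 * y 1 - x 1 * y 0

/-- Twice the signed area of the triangle `a b x`. -/
def orient (a b x : Plane) : ℝ := cross (b - a) (x - a)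

lemma orient_def (a b x : Plane) :
    orient a b x = (b 0 - a 0) * (x 1 - a 1) - (b 1 - a 1) * (x 0 - a 0) := rfl

lemma orient_rotate (a b c : Plane) : orient b c a = orient a b c := by
  simp only [orient_def]; ring

lemma orient_swap_right (a b c : Plane) : orient a c b = -orient a b c := by
  simp only [orient_def]; ring

lemma orient_add_orient_add_orient (a b c x : Plane) :
    orient a b x + orient b c x + orient c a x = orient a b c := by
  simp only [orient_def]; ring

lemma orient_lineMap (a b x y : Plane) (s : ℝ) :
    orient a b (x + s • (y - x)) = (1 - s) * orient a b x + s * orient a b y := by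
  simp only [orient_def, PiLp.add_apply, PiLp.smul_apply, PiLp.sub_apply, smul_eq_mul]; ring

lemma continuous_orient : Continuous fun p : Plane × Plane × Plane => orient p.1 p.2.1 p.2.2 := by
  unfold orient cross; fun_prop

@[fun_prop]
lemma Continuous.orient {X : Type*} [TopologicalSpace X] {a b x : X → Plane} (ha : Continuous a)
    (hb : Continuous b) (hx : Continuous x) : Continuous fun p => orient (a p) (b p) (x p) :=
  continuous_orient.comp (ha.prodMk (hb.prodMk hx))

lemma mem_segment_iff_exists {a b x : Plane} :
    x ∈ segment ℝ a b ↔ ∃ s ∈ Icc (0 : ℝ) 1, a + s • (b - a) = x := by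
  rw [segment_eq_image', mem_image]

lemma orient_eq_zero_of_mem_segment {a b x : Plane} (h : x ∈ segment ℝ a b) :
    orient a b x = 0 := by
  obtain ⟨s, -, rfl⟩ := mem_segment_iff_exists.1 h
  rw [orient_lineMap]
  simp only [orient_def]; ring

/-- A vanishing criterion for the concurrency of the lines `a b`, `c d` and `e f`. -/
def concurrency (a b c d e f : Plane) : ℝ :=
  cross a b * cross (d - c) (f - e) + cross c d * cross (f - e) (b - a)
    + cross e f * cross (b - a) (d - c)

/-- Since `orient a b p = cross (b - a) p + cross a b`, the hypotheses are three affine equations in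
`p`. Weighting each by the cross product of the other two directions, in cyclic order, cancels `p`
and leaves `concurrency`. -/
lemma concurrency_eq_zero {a b c d e f p : Plane} (h₁ : orient a b p = 0) (h₂ : orient c d p = 0)
    (h₃ : orient e f p = 0) : concurrency a b c d e f = 0 := by
  simp only [orient_def, concurrency, cross, PiLp.sub_apply] at *
  linear_combination
    ((d 0 - c 0) * (f 1 - e 1) - (d 1 - c 1) * (f 0 - e 0)) * h₁
    + ((f 0 - e 0) * (b 1 - a 1) - (f 1 - e 1) * (b 0 - a 0)) * h₂
    + ((b 0 - a 0) * (d 1 - c 1) - (b 1 - a 1) * (d 0 - c 0)) * h₃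

/-- If two lines share two points, then all the four points spanning them are collinear. -/
lemma orient_eq_zero_of_mem_of_mem {a b c d p q : Plane} (hpq : p ≠ q)
    (hp : p ∈ segment ℝ a b) (hq : q ∈ segment ℝ a b) (hp' : p ∈ segment ℝ c d)
    (hq' : q ∈ segment ℝ c d) : orient c d a = 0 ∧ orient c d b = 0 := by
  have h1 := orient_eq_zero_of_mem_segment hp'
  have h2 := orient_eq_zero_of_mem_segment hq'
  obtain ⟨s, -, rfl⟩ := mem_segment_iff_exists.1 hp
  obtain ⟨t, -, rfl⟩ := mem_segment_iff_exists.1 hq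
  have hst : s - t ≠ 0 := fun h => hpq (by rw [sub_eq_zero.1 h])
  rw [orient_lineMap] at h1 h2
  have h3 : orient c d a = orient c d b := by
    apply mul_left_cancel₀ hst
    linear_combination h2 - h1
  rw [← h3] at h1 ⊢
  have : orient c d a = 0 := by linear_combination h1
  exact ⟨this, this⟩

/-! ### General position and the straight-line drawing. -/

/-- Points of the plane are in general position with respect to the origin. -/
structure GeneralPosition {V : Type} (P : V → Plane) : Prop where
  orient_ne : ∀ i j k, i ≠ j → i ≠ k → j ≠ k → orient (P i) (P j) (P k) ≠ 0
  orient_zero_ne : ∀ i j, i ≠ j → orient (P i) (P j) 0 ≠ 0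
  concurrency_ne : ∀ a b c d e f, [a, b, c, d, e, f].Nodup →
    concurrency (P a) (P b) (P c) (P d) (P e) (P f) ≠ 0

/-- The straight-line edge between two vertices. -/
def straightEdge {V : Type} (P : V → Plane) : Sym2 V → Set Plane :=
  Sym2.lift ⟨fun u v => segment ℝ (P u) (P v), fun u v => segment_symm ℝ (P u) (P v)⟩

lemma isSimpleArc_segment {a b : Plane} (h : a ≠ b) : IsSimpleArc a b (segment ℝ a b) := by
  refine ⟨⟨⟨fun s => a + (s : ℝ) • (b - a), by fun_prop⟩, by simp, by simp⟩, ?_, ?_⟩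
  · intro s t hst
    have : (s : ℝ) • (b - a) = (t : ℝ) • (b - a) := add_left_cancel hst
    exact Subtype.ext (smul_left_injective ℝ (sub_ne_zero.2 h.symm) this)
  · ext x
    rw [mem_segment_iff_exists]
    constructor
    · rintro ⟨s, rfl⟩; exact ⟨s, s.2, rfl⟩
    · rintro ⟨s, hs, rfl⟩; exact ⟨⟨s, hs⟩, rfl⟩

/-- On the line through `a` and `b`, the inner product with `b - a` is the segment parameter up to
scale. This is what lets a segment be described near an inner point by one linear equation. -/
lemma mem_segment_of_inner {a b p x : Plane} (hp : p ∈ segment ℝ a b) (hab : a ≠ b)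
    (hc : cross (b - a) (x - p) = 0) (h0 : 0 ≤ inner ℝ (b - a) (x - a))
    (h1 : inner ℝ (b - a) (x - a) ≤ inner ℝ (b - a) (b - a)) : x ∈ segment ℝ a b := by
  have hp := orient_eq_zero_of_mem_segment hp
  have hpos : 0 < inner ℝ (b - a) (b - a) := real_inner_self_pos.2 (sub_ne_zero.2 hab.symm)
  rw [mem_segment_iff_exists]
  refine ⟨inner ℝ (b - a) (x - a) / inner ℝ (b - a) (b - a), ⟨by positivity, ?_⟩, ?_⟩
  · rwa [div_le_one hpos]
  · have hxa : cross (b - a) (x - a) = 0 := by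
      simp only [orient, cross, PiLp.sub_apply] at *
      linear_combination hc + hp
    simp only [PiLp.inner_apply, Fin.sum_univ_two, RCLike.inner_apply, conj_trivial,
      PiLp.sub_apply, cross] at *
    have ht := div_mul_cancel₀ ((x 0 - a 0) * (b 0 - a 0) + (x 1 - a 1) * (b 1 - a 1)) hpos.ne'
    apply Plane.ext <;> simp only [PiLp.add_apply, PiLp.smul_apply, PiLp.sub_apply, smul_eq_mul] <;>
      apply mul_left_cancel₀ hpos.ne'
    · linear_combination (b 0 - a 0) * ht + (b 1 - a 1) * hxa
    · linear_combination (b 1 - a 1) * ht - (b 0 - a 0) * hxa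

lemma cross_eq_zero_of_mem_segment {a b p x : Plane} (hp : p ∈ segment ℝ a b)
    (hx : x ∈ segment ℝ a b) : cross (b - a) (x - p) = 0 := by
  have h1 := orient_eq_zero_of_mem_segment hp
  have h2 := orient_eq_zero_of_mem_segment hx
  simp only [orient, cross, PiLp.sub_apply] at *
  linear_combination h2 - h1

lemma inner_pos_of_mem_segment {a b p : Plane} (hp : p ∈ segment ℝ a b) (ha : p ≠ a) (hb : p ≠ b) :
    0 < inner ℝ (b - a) (p - a) ∧ inner ℝ (b - a) (p - a) < inner ℝ (b - a) (b - a) := by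
  obtain ⟨s, ⟨hs0, hs1⟩, rfl⟩ := mem_segment_iff_exists.1 hp
  have hab : b - a ≠ 0 := fun h => ha (by simp [h])
  have hs0 : 0 < s := lt_of_le_of_ne hs0 (by rintro rfl; simp at ha)
  have hs1 : s < 1 := lt_of_le_of_ne hs1 (by rintro rfl; simp at hb)
  have hpos : 0 < inner ℝ (b - a) (b - a) := real_inner_self_pos.2 hab
  rw [add_sub_cancel_left, inner_smul_right]
  exact ⟨by positivity, by nlinarith⟩

/-- Straightening two non-parallel directions `v`, `w` at a point `p` to the coordinate axes. -/
lemma exists_homeomorph_cross {v w : Plane} (h : cross v w ≠ 0) (p : Plane) :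
    ∃ φ : Plane ≃ₜ Plane, ∀ x, φ x 1 = cross v (x - p) ∧ φ x 0 = cross w (x - p) := by
  obtain ⟨i, hi⟩ : ∃ i, cross v w * i = 1 := ⟨_, mul_inv_cancel₀ h⟩
  refine ⟨⟨⟨fun x => !₂[cross w (x - p), cross v (x - p)],
    fun y => p + (y 1 * i) • w - (y 0 * i) • v, fun x => ?_, fun y => ?_⟩,
    ?_, ?_⟩, fun x => ⟨rfl, rfl⟩⟩
  · simp only [cross] at hi
    apply Plane.ext <;> simp [cross]
    · linear_combination (x 0 - p 0) * hi
    · linear_combination (x 1 - p 1) * hi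
  · simp only [cross] at hi
    apply Plane.ext <;> simp [cross]
    · linear_combination y 0 * hi
    · linear_combination y 1 * hi
  · refine (PiLp.continuous_toLp 2 _).comp (continuous_pi fun i => ?_)
    fin_cases i <;> simp [cross] <;> fun_prop
  · change Continuous fun y : Plane => p + (y 1 * i) • w - (y 0 * i) • v
    fun_prop

lemma crossAt_segment {a b c d p : Plane} (hp : p ∈ segment ℝ a b) (hp' : p ∈ segment ℝ c d)
    (ha : p ≠ a) (hb : p ≠ b) (hc : p ≠ c) (hd : p ≠ d) (h : cross (b - a) (d - c) ≠ 0) :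
    CrossAt (segment ℝ a b) (segment ℝ c d) p := by
  obtain ⟨φ, hφ⟩ := exists_homeomorph_cross h p
  have hab : a ≠ b := by rintro rfl; simp [cross] at h
  have hcd : c ≠ d := by rintro rfl; simp [cross] at h
  -- On the open strip intersection `S` both projections are strictly between the end-points, so
  -- each segment coincides there with its whole line, which the affine chart `φ` maps into an axis.
  let S : Set Plane := {x | (0 < inner ℝ (b - a) (x - a) ∧
    inner ℝ (b - a) (x - a) < inner ℝ (b - a) (b - a)) ∧ 0 < inner ℝ (d - c) (x - c) ∧
    inner ℝ (d - c) (x - c) < inner ℝ (d - c) (d - c)}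
  have hS : IsOpen S := by
    have aux : ∀ u v : Plane, IsOpen {x : Plane | 0 < inner ℝ (v - u) (x - u) ∧
        inner ℝ (v - u) (x - u) < inner ℝ (v - u) (v - u)} := fun u v => by
      rw [ofPred_and]
      exact (isOpen_lt (by fun_prop) (by fun_prop)).inter (isOpen_lt (by fun_prop) (by fun_prop))
    exact (aux a b).inter (aux c d)
  refine ⟨φ.toOpenPartialHomeomorph.restrOpen S hS, ?_, ?_, fun x hx => ?_⟩
  · exact ⟨trivial, inner_pos_of_mem_segment hp ha hb, inner_pos_of_mem_segment hp' hc hd⟩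
  · exact Plane.ext ((hφ p).2.trans (by simp [cross])) ((hφ p).1.trans (by simp [cross]))
  · obtain ⟨-, hx1, hx2⟩ := hx
    change (_ ↔ φ x 1 = 0) ∧ (_ ↔ φ x 0 = 0)
    rw [(hφ x).1, (hφ x).2]
    exact ⟨⟨cross_eq_zero_of_mem_segment hp,
        fun h => mem_segment_of_inner hp hab h hx1.1.le hx1.2.le⟩,
      ⟨cross_eq_zero_of_mem_segment hp',
        fun h => mem_segment_of_inner hp' hcd h hx2.1.le hx2.2.le⟩⟩

namespace GeneralPosition

variable {V : Type} {P : V → Plane} (hP : GeneralPosition P)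
include hP

lemma injective : Function.Injective P := by
  intro i j h
  by_contra hij
  exact hP.orient_zero_ne i j hij (by rw [h]; simp [orient_def])

lemma mem_of_mem_straightEdge (e : Sym2 V) (w : V) (he : ¬ e.IsDiag)
    (hw : P w ∈ straightEdge P e) : w ∈ e := by
  induction e using Sym2.ind with
  | _ a b =>
    by_contra h
    rw [Sym2.mem_iff, not_or] at h
    exact hP.orient_ne a b w (by simpa using he) (Ne.symm h.1) (Ne.symm h.2)
      (orient_eq_zero_of_mem_segment hw)

/-- Distinct edges cannot have both ends in common, and an end outside `{c, d}` is off the line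
through `P c` and `P d`. -/
lemma exists_orient_ne {a b c d : V} (hab : a ≠ b) (hcd : c ≠ d) (h : s(a, b) ≠ s(c, d)) :
    orient (P c) (P d) (P a) ≠ 0 ∨ orient (P c) (P d) (P b) ≠ 0 := by
  by_cases ha : a = c ∨ a = d
  · refine Or.inr (hP.orient_ne c d b hcd ?_ ?_) <;> rintro rfl <;> rcases ha with rfl | rfl <;>
      simp_all
  · rw [not_or] at ha
    exact Or.inl (hP.orient_ne c d a hcd (Ne.symm ha.1) (Ne.symm ha.2))

lemma straightEdge_inter_subsingleton (e f : Sym2 V) (he : ¬ e.IsDiag) (hf : ¬ f.IsDiag)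
    (hef : e ≠ f) : (straightEdge P e ∩ straightEdge P f).Subsingleton := by
  induction e using Sym2.ind with
  | _ a b =>
  induction f using Sym2.ind with
  | _ c d =>
    intro p hp q hq
    by_contra hpq
    obtain ⟨h1, h2⟩ := orient_eq_zero_of_mem_of_mem hpq hp.1 hq.1 hp.2 hq.2
    exact (hP.exists_orient_ne (by simpa using he) (by simpa using hf) hef).elim
      (fun h => h h1) (fun h => h h2)

lemma vertex_or_crossAt_straightEdge (e f : Sym2 V) (he : ¬ e.IsDiag) (hf : ¬ f.IsDiag)
    (hef : e ≠ f) (p : Plane) (hp : p ∈ straightEdge P e ∩ straightEdge P f) :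
    (∃ v, v ∈ e ∧ v ∈ f ∧ P v = p) ∨ CrossAt (straightEdge P e) (straightEdge P f) p := by
  by_cases hv : ∃ v, P v = p
  · obtain ⟨v, rfl⟩ := hv
    exact Or.inl ⟨v, hP.mem_of_mem_straightEdge e v he hp.1,
      hP.mem_of_mem_straightEdge f v hf hp.2, rfl⟩
  · rw [not_exists] at hv
    right
    induction e using Sym2.ind with
    | _ a b =>
    induction f using Sym2.ind with
    | _ c d =>
      have hv' : ∀ v, p ≠ P v := fun v h => hv v h.symm
      refine crossAt_segment hp.1 hp.2 (hv' a) (hv' b) (hv' c) (hv' d) fun h => ?_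
      have h1 := orient_eq_zero_of_mem_segment hp.2
      obtain ⟨s, -, hs⟩ := mem_segment_iff_exists.1 hp.1
      -- Parallel lines with a common point coincide, which would put both `P a` and `P b` on the
      -- line through `P c` and `P d`.
      have key : ∀ r : ℝ, orient (P c) (P d) (P a + r • (P b - P a)) = 0 := by
        intro r
        rw [← hs] at h1
        simp only [orient, cross, PiLp.add_apply, PiLp.smul_apply, PiLp.sub_apply,
          smul_eq_mul] at *
        linear_combination h1 + (s - r) * h
      refine (hP.exists_orient_ne (by simpa using he) (by simpa using hf) hef).elim
        (fun h => h ?_) (fun h => h ?_)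
      · simpa using key 0
      · simpa using key 1

/-- Two of the edges sharing an end already meet there, hence nowhere else. At a point that is not a
vertex all six ends are therefore distinct, and the concurrency condition applies. -/
lemma no_three_cross_straightEdge (e f g : Sym2 V) (he : ¬ e.IsDiag) (hf : ¬ f.IsDiag)
    (hg : ¬ g.IsDiag) (hef : e ≠ f) (heg : e ≠ g) (hfg : f ≠ g) (p : Plane)
    (hp : p ∈ straightEdge P e ∩ straightEdge P f ∩ straightEdge P g) : ∃ v, P v = p := by
  obtain ⟨⟨hpe, hpf⟩, hpg⟩ := hp
  by_contra hv
  have mem : ∀ {e : Sym2 V} {v : V}, v ∈ e → P v ∈ straightEdge P e := by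
    intro e v hve
    induction e using Sym2.ind with
    | _ a b =>
      rcases Sym2.mem_iff.1 hve with rfl | rfl
      · exact left_mem_segment ℝ _ _
      · exact right_mem_segment ℝ _ _
  have disj : ∀ {e f : Sym2 V}, ¬ e.IsDiag → ¬ f.IsDiag → e ≠ f → p ∈ straightEdge P e →
      p ∈ straightEdge P f → ∀ v ∈ e, v ∉ f := fun he hf hef hpe hpf v hve hvf =>
    hv ⟨v, hP.straightEdge_inter_subsingleton _ _ he hf hef ⟨mem hve, mem hvf⟩ ⟨hpe, hpf⟩⟩
  have h1 := disj he hf hef hpe hpf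
  have h2 := disj he hg heg hpe hpg
  have h3 := disj hf hg hfg hpf hpg
  induction e using Sym2.ind with
  | _ a b =>
  induction f using Sym2.ind with
  | _ c d =>
  induction g using Sym2.ind with
  | _ x y =>
    refine hP.concurrency_ne a b c d x y ?_ (concurrency_eq_zero
      (orient_eq_zero_of_mem_segment hpe) (orient_eq_zero_of_mem_segment hpf)
      (orient_eq_zero_of_mem_segment hpg))
    simp_all

/-- The straight-line drawing on points in general position. -/
def drawing : TopologicalDrawing V where
  vertex := P
  edge := straightEdge P
  vertex_injective := hP.injective
  edge_isSimpleArc _ _ huv := isSimpleArc_segment (hP.injective.ne huv)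
  mem_of_vertex_mem_edge := hP.mem_of_mem_straightEdge
  edge_inter_subsingleton := hP.straightEdge_inter_subsingleton
  vertex_or_crossAt := hP.vertex_or_crossAt_straightEdge
  no_three_cross := hP.no_three_cross_straightEdge

lemma isStraightLine_drawing : hP.drawing.IsStraightLine := fun _ _ _ => rfl

lemma zero_notMem_support [Nontrivial V] : (0 : Plane) ∉ hP.drawing.support := by
  rintro (⟨v, hv⟩ | h)
  · obtain ⟨w, hw⟩ := exists_ne v
    refine hP.orient_zero_ne v w hw.symm ?_
    change P v = 0 at hv
    simp [hv, orient_def]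
  · simp only [mem_iUnion] at h
    obtain ⟨e, he, h⟩ := h
    induction e using Sym2.ind with
    | _ a b =>
      exact hP.orient_zero_ne a b (by simpa using he) (orient_eq_zero_of_mem_segment h)

end GeneralPosition

/-! ### Connectedness and components -/

/-- A small punctured disc around `p` is connected, so in a separation of `U \ {p}` it lies on one
side. Adding the disc to that side would separate `U`. -/
lemma isPreconnected_diff_singleton {U : Set Plane} (hU : IsOpen U) (hc : IsPreconnected U)
    (p : Plane) : IsPreconnected (U \ {p}) := by
  by_cases hp : p ∈ U
  swap
  · rwa [sdiff_singleton_eq_self hp]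
  obtain ⟨r, hr, hB⟩ := Metric.isOpen_iff.1 hU p hp
  have hrank : 1 < Module.rank ℝ Plane := by
    rw [← Module.finrank_eq_rank, finrank_euclideanSpace_fin]; norm_num
  have hBp : IsPreconnected (Metric.ball p r \ {p}) := by
    have h := (isConnected_compl_singleton_of_one_lt_rank hrank (0 : Plane)).isPreconnected.image
      (OpenPartialHomeomorph.univBall p r) (OpenPartialHomeomorph.continuous_univBall p r).continuousOn
    convert h using 1
    have h1 := (OpenPartialHomeomorph.univBall p r).image_source_eq_target
    rw [OpenPartialHomeomorph.univBall_source, OpenPartialHomeomorph.univBall_target p hr] at h1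
    have hinj : Function.Injective (OpenPartialHomeomorph.univBall p r) := by
      have := (OpenPartialHomeomorph.univBall p r).injOn
      rwa [OpenPartialHomeomorph.univBall_source, injOn_univ] at this
    rw [← h1, compl_eq_univ_sdiff, image_sdiff hinj, image_singleton,
      OpenPartialHomeomorph.univBall_apply_zero]
  rw [isPreconnected_iff_subset_of_disjoint] at hc hBp ⊢
  have key : ∀ u v : Set Plane, IsOpen u → IsOpen v → U \ {p} ⊆ u ∪ v →
      U \ {p} ∩ (u ∩ v) = ∅ → Metric.ball p r \ {p} ⊆ u → U \ {p} ⊆ u := by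
    intro u v hu hv huv hd hBu
    have hvp : IsOpen (v \ {p}) := hv.sdiff isClosed_singleton
    have hcov : U ⊆ (u ∪ Metric.ball p r) ∪ v \ {p} := by
      intro x hx
      by_cases hxp : x = p
      · exact Or.inl (Or.inr (hxp ▸ Metric.mem_ball_self hr))
      · exact (huv ⟨hx, hxp⟩).elim (fun h => Or.inl (Or.inl h)) fun h => Or.inr ⟨h, hxp⟩
    have hdis : U ∩ ((u ∪ Metric.ball p r) ∩ (v \ {p})) = ∅ := by
      refine eq_empty_of_forall_notMem ?_
      rintro x ⟨hx, hxu, hxv, hxp⟩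
      have hxu' : x ∈ u := hxu.elim id fun hxB => hBu ⟨hxB, hxp⟩
      exact (eq_empty_iff_forall_notMem.1 hd x) ⟨⟨hx, hxp⟩, hxu', hxv⟩
    rcases hc _ _ (hu.union Metric.isOpen_ball) hvp hcov hdis with h | h
    · rintro x ⟨hx, hxp⟩
      exact (h hx).elim id fun hxB => hBu ⟨hxB, hxp⟩
    · exact absurd rfl (h hp).2
  intro u v hu hv huv hd
  have hsub : Metric.ball p r \ {p} ⊆ U \ {p} := sdiff_subset_sdiff_left hB
  rcases hBp u v hu hv (hsub.trans huv)
    (subset_eq_empty (inter_subset_inter_left _ hsub) hd) with h | h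
  · exact Or.inl (key u v hu hv huv hd h)
  · exact Or.inr (key v u hv hu (by rwa [union_comm]) (by rwa [inter_comm v u]) h)

lemma connectedComponentIn_union_eq {X : Type*} [TopologicalSpace X] {A B : Set X} (hA : IsOpen A)
    (hB : IsOpen B) (hAB : Disjoint A B) (hc : IsPreconnected A) {p : X} (hp : p ∈ A) :
    connectedComponentIn (A ∪ B) p = A := by
  refine Subset.antisymm ?_ (hc.subset_connectedComponentIn hp subset_union_left)
  exact isPreconnected_connectedComponentIn.subset_left_of_subset_union hA hB hAB
    (connectedComponentIn_subset _ _) ⟨p, mem_connectedComponentIn (Or.inl hp), hp⟩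

lemma not_isBounded_of_mem_cobounded {s : Set Plane} (hs : s ∈ Bornology.cobounded Plane) :
    ¬ Bornology.IsBounded s := fun h =>
  NormedSpace.unbounded_univ ℝ Plane <| by
    rw [← union_compl_self s]
    exact h.union (by rwa [Bornology.isBounded_def, compl_compl])

/-! ### Triangles -/

/-- The closed triangle spanned by a positively oriented triple. -/
def closedTri (a b c : Plane) : Set Plane :=
  {x | 0 ≤ orient a b x ∧ 0 ≤ orient b c x ∧ 0 ≤ orient c a x}

/-- The open triangle spanned by a positively oriented triple. -/
def openTri (a b c : Plane) : Set Plane :=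
  {x | 0 < orient a b x ∧ 0 < orient b c x ∧ 0 < orient c a x}

lemma orient_combo (a b x y : Plane) {s t : ℝ} (hst : s + t = 1) :
    orient a b (s • x + t • y) = s * orient a b x + t * orient a b y := by
  obtain rfl : s = 1 - t := by linarith
  simp only [orient_def, PiLp.add_apply, PiLp.smul_apply, smul_eq_mul]; ring

lemma convex_orient_preimage (a b : Plane) {I : Set ℝ} (hI : Convex ℝ I) :
    Convex ℝ {x | orient a b x ∈ I} := by
  intro x hx y hy s t hs ht hst
  rw [mem_ofPred_eq, orient_combo a b x y hst]
  exact hI hx hy hs ht hst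

lemma convex_closedTri (a b c : Plane) : Convex ℝ (closedTri a b c) :=
  (convex_orient_preimage a b (convex_Ici 0)).inter
    ((convex_orient_preimage b c (convex_Ici 0)).inter (convex_orient_preimage c a (convex_Ici 0)))

lemma convex_openTri (a b c : Plane) : Convex ℝ (openTri a b c) :=
  (convex_orient_preimage a b (convex_Ioi 0)).inter
    ((convex_orient_preimage b c (convex_Ioi 0)).inter (convex_orient_preimage c a (convex_Ioi 0)))

lemma isOpen_setOf_orient_pos (a b : Plane) : IsOpen {x | 0 < orient a b x} :=
  isOpen_lt continuous_const (by fun_prop)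

lemma isClosed_setOf_orient_nonneg (a b : Plane) : IsClosed {x | 0 ≤ orient a b x} :=
  isClosed_le continuous_const (by fun_prop)

lemma isOpen_openTri (a b c : Plane) : IsOpen (openTri a b c) :=
  (isOpen_setOf_orient_pos a b).inter
    ((isOpen_setOf_orient_pos b c).inter (isOpen_setOf_orient_pos c a))

lemma isClosed_closedTri (a b c : Plane) : IsClosed (closedTri a b c) :=
  (isClosed_setOf_orient_nonneg a b).inter
    ((isClosed_setOf_orient_nonneg b c).inter (isClosed_setOf_orient_nonneg c a))

lemma openTri_subset_closedTri (a b c : Plane) : openTri a b c ⊆ closedTri a b c :=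
  fun _ hx => ⟨hx.1.le, hx.2.1.le, hx.2.2.le⟩

lemma closedTri_rotate (a b c : Plane) : closedTri b c a = closedTri a b c := by
  ext x; simp only [closedTri, mem_ofPred_eq]; tauto

lemma orient_self_left (a b : Plane) : orient a b a = 0 := by simp [orient_def]

lemma orient_self_right (a b : Plane) : orient a b b = 0 := by simp only [orient_def]; ring

lemma left_mem_closedTri {a b c : Plane} (h : 0 < orient a b c) : a ∈ closedTri a b c :=
  ⟨(orient_self_left a b).ge, (orient_rotate a b c).ge.trans' h.le, (orient_self_right c a).ge⟩

lemma barycentric {a b c : Plane} (h : 0 < orient a b c) (x : Plane) :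
    x = (orient b c x / orient a b c) • a + (orient c a x / orient a b c) • b +
      (orient a b x / orient a b c) • c := by
  have h' := h.ne'
  apply Plane.ext <;> simp only [PiLp.add_apply, PiLp.smul_apply, smul_eq_mul] <;>
    field_simp <;> simp only [orient_def] <;> ring

lemma closedTri_subset_convexHull {a b c : Plane} (h : 0 < orient a b c) :
    closedTri a b c ⊆ convexHull ℝ {a, b, c} := by
  intro x hx
  rw [barycentric h x]
  have hs := orient_add_orient_add_orient a b c x
  have mem : ∀ y ∈ ({a, b, c} : Set Plane), y ∈ convexHull ℝ {a, b, c} :=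
    fun y hy => subset_convexHull ℝ _ hy
  have H := (convex_convexHull ℝ {a, b, c}).sum_mem (t := Finset.univ)
    (w := ![orient b c x / orient a b c, orient c a x / orient a b c, orient a b x / orient a b c])
    (z := ![a, b, c]) ?_ ?_ ?_
  · rw [Fin.sum_univ_three] at H
    exact H
  · intro i _
    fin_cases i
    · exact div_nonneg hx.2.1 h.le
    · exact div_nonneg hx.2.2 h.le
    · exact div_nonneg hx.1 h.le
  · rw [Fin.sum_univ_three]
    simp only [Matrix.cons_val]
    rw [← add_div, ← add_div, div_eq_one_iff_eq h.ne']
    linarith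
  · intro i _
    fin_cases i <;> exact mem _ (by simp)

lemma isBounded_closedTri {a b c : Plane} (h : 0 < orient a b c) :
    Bornology.IsBounded (closedTri a b c) :=
  ((isBounded_convexHull.2 (toFinite _).isBounded)).subset (closedTri_subset_convexHull h)

lemma mem_segment_of_mem_closedTri {a b c x : Plane} (h : 0 < orient a b c)
    (hx : x ∈ closedTri a b c) (h0 : orient a b x = 0) : x ∈ segment ℝ a b := by
  have hs := orient_add_orient_add_orient a b c x
  refine ⟨orient b c x / orient a b c, orient c a x / orient a b c, div_nonneg hx.2.1 h.le,
    div_nonneg hx.2.2 h.le, ?_, ?_⟩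
  · rw [← add_div, div_eq_one_iff_eq h.ne']; linarith
  · have := barycentric h x
    rw [h0, zero_div, zero_smul, add_zero] at this
    exact this.symm

lemma closedTri_diff_openTri {a b c : Plane} (h : 0 < orient a b c) :
    closedTri a b c \ openTri a b c = segment ℝ a b ∪ segment ℝ b c ∪ segment ℝ c a := by
  have h1 : 0 < orient b c a := by rwa [orient_rotate]
  have h2 : 0 < orient c a b := by rwa [orient_rotate]
  have ha := left_mem_closedTri h
  have hb := closedTri_rotate a b c ▸ left_mem_closedTri h1
  have hc : c ∈ closedTri a b c := by
    rw [← closedTri_rotate, ← closedTri_rotate]; exact left_mem_closedTri h2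
  have hconv := convex_closedTri a b c
  ext x
  constructor
  · rintro ⟨hx, hx'⟩
    by_cases e1 : orient a b x = 0
    · exact Or.inl (Or.inl (mem_segment_of_mem_closedTri h hx e1))
    by_cases e2 : orient b c x = 0
    · exact Or.inl (Or.inr (mem_segment_of_mem_closedTri h1 (by rwa [closedTri_rotate]) e2))
    by_cases e3 : orient c a x = 0
    · exact Or.inr (mem_segment_of_mem_closedTri h2
        (by rwa [closedTri_rotate, closedTri_rotate]) e3)
    exact absurd ⟨lt_of_le_of_ne hx.1 (Ne.symm e1), lt_of_le_of_ne hx.2.1 (Ne.symm e2),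
      lt_of_le_of_ne hx.2.2 (Ne.symm e3)⟩ hx'
  · rintro ((hx | hx) | hx)
    · exact ⟨hconv.segment_subset ha hb hx,
        fun h => h.1.ne' (orient_eq_zero_of_mem_segment hx)⟩
    · exact ⟨hconv.segment_subset hb hc hx,
        fun h => h.2.1.ne' (orient_eq_zero_of_mem_segment hx)⟩
    · exact ⟨hconv.segment_subset hc ha hx,
        fun h => h.2.2.ne' (orient_eq_zero_of_mem_segment hx)⟩

lemma nonempty_openTri {a b c : Plane} (h : 0 < orient a b c) : (openTri a b c).Nonempty := by
  have key : ∀ u v w : Plane, 0 < orient u v w →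
      0 < orient u v ((1 / 3 : ℝ) • (u + v + w)) := by
    intro u v w h
    have : orient u v ((1 / 3 : ℝ) • (u + v + w)) = 1 / 3 * orient u v w := by
      simp only [orient_def, PiLp.add_apply, PiLp.smul_apply, smul_eq_mul]; ring
    rw [this]; positivity
  refine ⟨(1 / 3 : ℝ) • (a + b + c), key a b c h, ?_, ?_⟩
  · convert key b c a (by rwa [orient_rotate]) using 3; abel
  · convert key c a b (by rwa [orient_rotate, orient_rotate]) using 3; abel

lemma closedTri_subset_closure_openTri {a b c : Plane} (h : 0 < orient a b c) :
    closedTri a b c ⊆ closure (openTri a b c) := by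
  intro x hx
  obtain ⟨g, hg⟩ := nonempty_openTri h
  have hsub : openSegment ℝ g x ⊆ openTri a b c := by
    rintro y ⟨s, t, hs, ht, hst, rfl⟩
    have key : ∀ u v, 0 < orient u v g → 0 ≤ orient u v x → 0 < orient u v (s • g + t • x) := by
      intro u v h1 h2
      rw [orient_combo u v g x hst]
      positivity
    exact ⟨key _ _ hg.1 hx.1, key _ _ hg.2.1 hx.2.1, key _ _ hg.2.2 hx.2.2⟩
  exact closure_mono hsub (segment_subset_closure_openSegment (right_mem_segment ℝ g x))

lemma isPreconnected_openTri_diff (a b c p : Plane) : IsPreconnected (openTri a b c \ {p}) :=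
  isPreconnected_diff_singleton (isOpen_openTri a b c) (convex_openTri a b c).isPreconnected p

/-- The complement is a union of three open half-planes, consecutive ones of which overlap beyond
the common corner. -/
lemma isPreconnected_closedTri_compl {a b c : Plane} (h : 0 < orient a b c) :
    IsPreconnected (closedTri a b c)ᶜ := by
  have hH : ∀ u v : Plane, IsPreconnected {x | orient u v x < 0} := fun u v =>
    (convex_orient_preimage u v (convex_Iio 0)).isPreconnected
  have meet : ∀ u v w : Plane, 0 < orient u v w →
      ({x | orient u v x < 0} ∩ {x | orient v w x < 0}).Nonempty := by
    intro u v w h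
    -- This point is `v + (v - u) + (v - w)`, past the corner `v`.
    refine ⟨(3 : ℝ) • v - u - w, ?_, ?_⟩
    · have : orient u v ((3 : ℝ) • v - u - w) = -orient u v w := by
        simp only [orient_def, PiLp.sub_apply, PiLp.smul_apply, smul_eq_mul]; ring
      rw [mem_ofPred_eq, this]; linarith
    · have : orient v w ((3 : ℝ) • v - u - w) = -orient u v w := by
        simp only [orient_def, PiLp.sub_apply, PiLp.smul_apply, smul_eq_mul]; ring
      rw [mem_ofPred_eq, this]; linarith
  have h1 : 0 < orient b c a := by rwa [orient_rotate]
  have e : (closedTri a b c)ᶜ =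
      ({x | orient a b x < 0} ∪ {x | orient b c x < 0}) ∪ {x | orient c a x < 0} := by
    ext x
    simp only [closedTri, mem_compl_iff, mem_ofPred_eq, mem_union, not_and_or, not_le, or_assoc]
  rw [e]
  refine IsPreconnected.union' ?_ (IsPreconnected.union' (meet a b c h) (hH _ _) (hH _ _)) (hH _ _)
  exact (meet b c a h1).mono (inter_subset_inter_left _ subset_union_right)

/-! ### The two sides of an inverted triangle -/

/-- The image under inversion of the inside of a triangle, without the origin. -/
def innerSide (a b c : Plane) : Set Plane := {x | x ≠ 0 ∧ planeInv x ∈ openTri a b c}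

/-- The image under inversion of the outside of a triangle, with the point at infinity. -/
def outerSide (a b c : Plane) : Set Plane := {x | x = 0 ∨ planeInv x ∉ closedTri a b c}

lemma innerSide_eq (a b c : Plane) : innerSide a b c = planeInv '' (openTri a b c \ {0}) := by
  ext x
  rw [mem_planeInv_image, mem_sdiff, mem_singleton_iff, planeInv_eq_zero, and_comm]
  rfl

lemma outerSide_eq (a b c : Plane) :
    outerSide a b c = insert 0 (planeInv '' ((closedTri a b c)ᶜ \ {0})) := by
  ext x
  rw [mem_insert_iff, mem_planeInv_image, mem_sdiff, mem_singleton_iff, planeInv_eq_zero]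
  simp only [outerSide, mem_ofPred_eq, mem_compl_iff]
  tauto

lemma disjoint_innerSide_outerSide (a b c : Plane) :
    Disjoint (innerSide a b c) (outerSide a b c) :=
  disjoint_left.2 fun _ hx hx' =>
    hx'.elim hx.1 fun h => h (openTri_subset_closedTri _ _ _ hx.2)

lemma isOpen_innerSide (a b c : Plane) : IsOpen (innerSide a b c) := by
  rw [innerSide_eq]
  exact isOpen_planeInv_image ((isOpen_openTri a b c).sdiff isClosed_singleton) (by simp)

lemma outerSide_mem_nhds_zero {a b c : Plane} (h : 0 < orient a b c) :
    outerSide a b c ∈ nhds 0 := by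
  have hK : (closedTri a b c)ᶜ ∈ Bornology.cobounded Plane := isBounded_closedTri h
  have h1 := tendsto_planeInv_nhdsNE_zero hK
  rw [Filter.mem_map, mem_nhdsWithin_iff_eventually] at h1
  filter_upwards [h1] with x hx
  by_cases hx0 : x = 0
  · exact Or.inl hx0
  · exact Or.inr (hx hx0)

lemma isOpen_outerSide {a b c : Plane} (h : 0 < orient a b c) : IsOpen (outerSide a b c) := by
  have ho : IsOpen (planeInv '' ((closedTri a b c)ᶜ \ {0})) :=
    isOpen_planeInv_image ((isClosed_closedTri a b c).isOpen_compl.sdiff isClosed_singleton)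
      (by simp)
  rw [isOpen_iff_mem_nhds]
  intro x hx
  by_cases hx0 : x = 0
  · exact hx0 ▸ outerSide_mem_nhds_zero h
  · rw [outerSide_eq] at hx ⊢
    exact Filter.mem_of_superset (ho.mem_nhds (hx.resolve_left hx0)) (subset_insert _ _)

lemma isPreconnected_innerSide (a b c : Plane) : IsPreconnected (innerSide a b c) := by
  rw [innerSide_eq]
  exact (isPreconnected_openTri_diff a b c 0).image _ (continuousOn_planeInv (by simp))

lemma isPreconnected_outerSide {a b c : Plane} (h : 0 < orient a b c) :
    IsPreconnected (outerSide a b c) := by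
  have h1 : IsPreconnected (planeInv '' ((closedTri a b c)ᶜ \ {0})) :=
    (isPreconnected_diff_singleton (isClosed_closedTri a b c).isOpen_compl
      (isPreconnected_closedTri_compl h) 0).image _ (continuousOn_planeInv (by simp))
  have h2 := outerSide_mem_nhds_zero h
  rw [outerSide_eq] at h2 ⊢
  -- The punctured image is connected and accumulates at `0`, so adjoining `0` keeps it connected.
  refine h1.subset_closure (subset_insert _ _) (insert_subset ?_ subset_closure)
  rw [insert_eq, union_comm] at h2
  have h3 : planeInv '' ((closedTri a b c)ᶜ \ {0}) ∈ nhdsWithin 0 {0}ᶜ := by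
    filter_upwards [mem_nhdsWithin_of_mem_nhds h2, self_mem_nhdsWithin] with x hx hx0
    exact hx.resolve_right hx0
  have : (nhdsWithin (0 : Plane) {0}ᶜ).NeBot := inferInstance
  exact mem_closure_iff_nhdsWithin_neBot.2
    (Filter.NeBot.mono this (le_inf nhdsWithin_le_nhds (Filter.le_principal_iff.2 h3)))

lemma compl_planeInv_image_boundary {a b c : Plane} (h0 : (0 : Plane) ∉ closedTri a b c \ openTri a b c) :
    (planeInv '' (closedTri a b c \ openTri a b c))ᶜ = innerSide a b c ∪ outerSide a b c := by
  ext x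
  rw [mem_compl_iff, mem_planeInv_image]
  by_cases hx : x = 0
  · subst hx
    simpa [outerSide] using h0
  · simp only [mem_sdiff, mem_union, innerSide, outerSide, mem_ofPred_eq, hx, false_or, ne_eq,
      not_false_eq_true, true_and]
    tauto

/-- The closure cannot enter `outerSide`, which is open and disjoint from `innerSide`; the excluded
points are exactly those of `outerSide`. -/
lemma closure_innerSide_subset {a b c : Plane} (h : 0 < orient a b c) :
    closure (innerSide a b c) ⊆ {x | x ≠ 0 ∧ planeInv x ∈ closedTri a b c} := by
  intro x hx
  have := ((disjoint_innerSide_outerSide a b c).closure_left (isOpen_outerSide h)).notMem_of_mem_left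
    hx
  simpa only [outerSide, mem_ofPred_eq, not_or, not_not] using this

lemma subset_closure_innerSide {a b c : Plane} (h : 0 < orient a b c) :
    {x | x ≠ 0 ∧ planeInv x ∈ closedTri a b c} ⊆ closure (innerSide a b c) := by
  rintro x ⟨hx0, hx⟩
  have hy0 : planeInv x ≠ 0 := mt planeInv_eq_zero.1 hx0
  have h1 : planeInv x ∈ closure (openTri a b c \ {0}) := by
    have := (isOpen_compl_singleton (x := (0 : Plane))).inter_closure
      ⟨hy0, closedTri_subset_closure_openTri h hx⟩
    rwa [inter_comm] at this
  rw [innerSide_eq, ← planeInv_planeInv x]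
  exact mem_closure_image (continuousAt_planeInv hy0) h1

/-- Inversion exchanges neighbourhoods of the origin with neighbourhoods of infinity. Hence the
image of whichever side contains the origin is unbounded and the other image is bounded; this and
the next three lemmas are the resulting cases. -/
lemma isBounded_innerSide {a b c : Plane} (h0 : (0 : Plane) ∉ closedTri a b c) :
    Bornology.IsBounded (innerSide a b c) := by
  have := tendsto_planeInv_cobounded ((isClosed_closedTri a b c).isOpen_compl.mem_nhds h0)
  rw [Bornology.isBounded_def]
  filter_upwards [this] with x hx hx'
  exact hx (openTri_subset_closedTri _ _ _ hx'.2)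

lemma not_isBounded_outerSide {a b c : Plane} (h0 : (0 : Plane) ∉ closedTri a b c) :
    ¬ Bornology.IsBounded (outerSide a b c) := by
  have := tendsto_planeInv_cobounded ((isClosed_closedTri a b c).isOpen_compl.mem_nhds h0)
  refine not_isBounded_of_mem_cobounded ?_
  filter_upwards [this] with x hx
  exact Or.inr hx

lemma not_isBounded_innerSide {a b c : Plane} (h0 : (0 : Plane) ∈ openTri a b c) :
    ¬ Bornology.IsBounded (innerSide a b c) := by
  have := tendsto_planeInv_cobounded ((isOpen_openTri a b c).mem_nhds h0)
  refine not_isBounded_of_mem_cobounded ?_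
  filter_upwards [this, Bornology.eventually_ne_cobounded (0 : Plane)] with x hx hx0
  exact ⟨hx0, hx⟩

lemma isBounded_outerSide {a b c : Plane} (h0 : (0 : Plane) ∈ openTri a b c) :
    Bornology.IsBounded (outerSide a b c) := by
  have := tendsto_planeInv_cobounded ((isOpen_openTri a b c).mem_nhds h0)
  rw [Bornology.isBounded_def]
  filter_upwards [this, Bornology.eventually_ne_cobounded (0 : Plane)] with x hx hx0 hx'
  exact hx'.elim hx0 fun h => h (openTri_subset_closedTri _ _ _ hx)

/-! ### Face-convexity and bounded sides of the inverted drawing. -/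

namespace GeneralPosition

variable {V : Type} {P : V → Plane} (hP : GeneralPosition P)
include hP

lemma exists_orient_pos {t : Finset V} (ht : t.card = 3) :
    ∃ i j k, 0 < orient (P i) (P j) (P k) ∧ ∀ v, v ∈ t ↔ v = i ∨ v = j ∨ v = k := by
  classical
  obtain ⟨i, j, k, hij, hik, hjk, rfl⟩ := Finset.card_eq_three.1 ht
  rcases lt_or_gt_of_ne (hP.orient_ne i j k hij hik hjk) with h | h
  · refine ⟨i, k, j, ?_, fun v => by simp; tauto⟩
    rw [orient_swap_right]; linarith
  · exact ⟨i, j, k, h, fun v => by simp⟩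

omit hP in
lemma ne_of_orient_pos {i j k : V} (h : 0 < orient (P i) (P j) (P k)) :
    i ≠ j ∧ j ≠ k ∧ k ≠ i := by
  refine ⟨?_, ?_, ?_⟩ <;> rintro rfl <;> simp only [orient_def] at h <;> ring_nf at h <;>
    exact lt_irrefl _ h

lemma triangle_drawing {t : Finset V} {i j k : V} (h : 0 < orient (P i) (P j) (P k))
    (ht : ∀ v, v ∈ t ↔ v = i ∨ v = j ∨ v = k) :
    hP.drawing.triangle t =
      closedTri (P i) (P j) (P k) \ openTri (P i) (P j) (P k) := by
  obtain ⟨hij, hjk, hki⟩ := ne_of_orient_pos h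
  rw [closedTri_diff_openTri h]
  ext x
  simp only [TopologicalDrawing.triangle, mem_iUnion, mem_union]
  constructor
  · rintro ⟨e, ⟨he, het⟩, hx⟩
    induction e using Sym2.ind with
    | _ u v =>
      have huv : u ≠ v := by simpa using he
      change x ∈ segment ℝ (P u) (P v) at hx
      have hx' := hx
      rw [segment_symm] at hx'
      rcases (ht u).1 (het u (by simp)) with rfl | rfl | rfl <;>
      rcases (ht v).1 (het v (by simp)) with rfl | rfl | rfl <;> tauto
  · rintro ((hx | hx) | hx)
    · exact ⟨s(i, j), ⟨by simpa using hij, by simp [ht]⟩, hx⟩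
    · exact ⟨s(j, k), ⟨by simpa using hjk, by simp [ht]⟩, hx⟩
    · exact ⟨s(k, i), ⟨by simpa using hki, by simp [ht]⟩, hx⟩

variable [Nontrivial V]

/-- The drawing obtained from the straight-line drawing by inversion. -/
noncomputable def invertedDrawing : TopologicalDrawing V :=
  hP.drawing.inverted hP.zero_notMem_support

lemma compl_triangle_invertedDrawing {t : Finset V} {i j k : V}
    (h : 0 < orient (P i) (P j) (P k)) (ht : ∀ v, v ∈ t ↔ v = i ∨ v = j ∨ v = k) :
    (hP.invertedDrawing.triangle t)ᶜ =
      innerSide (P i) (P j) (P k) ∪ outerSide (P i) (P j) (P k) := by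
  rw [invertedDrawing, TopologicalDrawing.triangle_inverted, hP.triangle_drawing h ht]
  refine compl_planeInv_image_boundary fun h0 => hP.zero_notMem_support ?_
  rw [← hP.triangle_drawing h ht] at h0
  exact hP.drawing.triangle_subset_support t h0

/-- The face of the origin in the inverted drawing, that is, the image of the old unbounded face,
serves as `f_∞`. It always lies in `outerSide`, so only the closure of `innerSide` must be convex,
and that is the image of an ordinary closed triangle. -/
lemma isFaceConvex_invertedDrawing : hP.invertedDrawing.IsFaceConvex := by
  have h0 : (0 : Plane) ∉ hP.invertedDrawing.support := by
    rw [invertedDrawing, TopologicalDrawing.support_inverted, mem_planeInv_image, planeInv_zero]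
    exact hP.zero_notMem_support
  refine ⟨_, ⟨0, h0, rfl⟩, ?_⟩
  rintro t ht S ⟨p, hp, rfl⟩ hF
  obtain ⟨i, j, k, h, ht⟩ := hP.exists_orient_pos ht
  have hX := hP.compl_triangle_invertedDrawing h ht
  have hA := isOpen_innerSide (P i) (P j) (P k)
  have hB := isOpen_outerSide h
  have hd := disjoint_innerSide_outerSide (P i) (P j) (P k)
  rw [hX] at hp hF ⊢
  rcases hp with hp | hp
  · rw [connectedComponentIn_union_eq hA hB hd (isPreconnected_innerSide _ _ _) hp]
    intro u v huv hu hv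
    refine Subset.trans ?_ (subset_closure_innerSide h)
    have hu' := closure_innerSide_subset h hu
    have hv' := closure_innerSide_subset h hv
    change _ ∧ planeInv (planeInv (P u)) ∈ _ at hu'
    change _ ∧ planeInv (planeInv (P v)) ∈ _ at hv'
    rw [planeInv_planeInv] at hu' hv'
    intro x hx
    refine ⟨?_, (convex_closedTri _ _ _).segment_subset hu'.2 hv'.2 (mem_planeInv_image.1 hx)⟩
    rintro rfl
    exact h0 (hP.invertedDrawing.edge_subset_support (by simpa using huv) hx)
  -- The component `outerSide` contains the origin and hence the whole distinguished face, so this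
  -- side is exempt.
  · refine absurd ?_ hF
    rw [union_comm, connectedComponentIn_union_eq hB hA hd.symm (isPreconnected_outerSide h) hp]
    refine Subset.trans ?_ subset_closure
    refine isPreconnected_connectedComponentIn.subset_left_of_subset_union hB hA hd.symm ?_
      ⟨0, mem_connectedComponentIn h0, Or.inl rfl⟩
    rw [union_comm, ← hX]
    exact (connectedComponentIn_subset _ _).trans
      (compl_subset_compl.2 (hP.invertedDrawing.triangle_subset_support t))

lemma boundedSide_of_zero_notMem {t : Finset V} {i j k : V}
    (h : 0 < orient (P i) (P j) (P k)) (ht : ∀ v, v ∈ t ↔ v = i ∨ v = j ∨ v = k)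
    (h0 : (0 : Plane) ∉ closedTri (P i) (P j) (P k)) :
    hP.invertedDrawing.boundedSide t = closure (innerSide (P i) (P j) (P k)) := by
  have hA := isOpen_innerSide (P i) (P j) (P k)
  have hB := isOpen_outerSide h
  have hd := disjoint_innerSide_outerSide (P i) (P j) (P k)
  rw [TopologicalDrawing.boundedSide, hP.compl_triangle_invertedDrawing h ht]
  congr 1
  ext p
  constructor
  · rintro ⟨hp | hp, hb⟩
    · exact hp
    · rw [union_comm, connectedComponentIn_union_eq hB hA hd.symm
        (isPreconnected_outerSide h) hp] at hb
      exact absurd hb (not_isBounded_outerSide h0)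
  · intro hp
    refine ⟨Or.inl hp, ?_⟩
    rw [connectedComponentIn_union_eq hA hB hd (isPreconnected_innerSide _ _ _) hp]
    exact isBounded_innerSide h0

lemma boundedSide_of_zero_mem {t : Finset V} {i j k : V}
    (h : 0 < orient (P i) (P j) (P k)) (ht : ∀ v, v ∈ t ↔ v = i ∨ v = j ∨ v = k)
    (h0 : (0 : Plane) ∈ openTri (P i) (P j) (P k)) :
    hP.invertedDrawing.boundedSide t = closure (outerSide (P i) (P j) (P k)) := by
  have hA := isOpen_innerSide (P i) (P j) (P k)
  have hB := isOpen_outerSide h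
  have hd := disjoint_innerSide_outerSide (P i) (P j) (P k)
  rw [TopologicalDrawing.boundedSide, hP.compl_triangle_invertedDrawing h ht]
  congr 1
  ext p
  constructor
  · rintro ⟨hp | hp, hb⟩
    · rw [connectedComponentIn_union_eq hA hB hd (isPreconnected_innerSide _ _ _) hp] at hb
      exact absurd hb (not_isBounded_innerSide h0)
    · exact hp
  · intro hp
    refine ⟨Or.inr hp, ?_⟩
    rw [union_comm, connectedComponentIn_union_eq hB hA hd.symm (isPreconnected_outerSide h) hp]
    exact isBounded_outerSide h0

end GeneralPosition

/-! ### General position is generic -/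

section Generic

variable {V : Type} [Fintype V]

lemma analyticOnNhd_coord (i : V) (c : Fin 2) :
    AnalyticOnNhd ℝ (fun P : V → Plane => P i c) univ :=
  ((EuclideanSpace.proj (𝕜 := ℝ) c).comp
    (ContinuousLinearMap.proj (R := ℝ) (φ := fun _ : V => Plane) i)).analyticOnNhd univ

/-- By the identity theorem an analytic function that vanishes on a nonempty open set vanishes
identically, so one nonzero value makes the open set `f ≠ 0` dense. It then suffices to exhibit one
nondegenerate point configuration per condition. -/
lemma eventually_residual_ne_zero {f : (V → Plane) → ℝ} (hf : AnalyticOnNhd ℝ f univ)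
    (h : ∃ Q, f Q ≠ 0) : ∀ᶠ P in residual (V → Plane), f P ≠ 0 := by
  have hc : Continuous f := continuousOn_univ.1 hf.continuousOn
  refine residual_of_dense_open (isOpen_ne_fun hc continuous_const) ?_
  by_contra hd
  obtain ⟨Q, hQ⟩ := h
  have hd' : ∃ P, P ∉ closure {P | f P ≠ 0} := by
    by_contra hall
    exact hd fun P => by_contra fun hP => hall ⟨P, hP⟩
  obtain ⟨P, hP⟩ := hd'
  have h0 : f =ᶠ[nhds P] 0 := by
    filter_upwards [isClosed_closure.isOpen_compl.mem_nhds hP] with x hx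
    by_contra hx'
    exact hx (subset_closure hx')
  exact hQ (hf.eqOn_zero_of_preconnected_of_eventuallyEq_zero isPreconnected_univ (mem_univ P) h0
    (mem_univ Q))

lemma eventually_residual_orient_ne {i j k : V} (hij : i ≠ j) (hik : i ≠ k) (hjk : j ≠ k) :
    ∀ᶠ P : V → Plane in residual _, orient (P i) (P j) (P k) ≠ 0 := by
  classical
  have h := analyticOnNhd_coord (V := V)
  refine eventually_residual_ne_zero ?_
    ⟨fun v => if v = j then !₂[1, 0] else if v = k then !₂[0, 1] else 0, ?_⟩
  · simp only [orient_def]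
    exact (((h j 0).sub (h i 0)).mul ((h k 1).sub (h i 1))).sub
      (((h j 1).sub (h i 1)).mul ((h k 0).sub (h i 0)))
  · simp [orient_def, hij, hik, hjk.symm]

lemma eventually_residual_orient_zero_ne {i j : V} (hij : i ≠ j) :
    ∀ᶠ P : V → Plane in residual _, orient (P i) (P j) 0 ≠ 0 := by
  classical
  have h := analyticOnNhd_coord (V := V)
  refine eventually_residual_ne_zero ?_
    ⟨fun v => if v = j then !₂[1, 0] else !₂[0, 1], ?_⟩
  · simp only [orient_def, PiLp.zero_apply, zero_sub]
    exact (((h j 0).sub (h i 0)).mul (h i 1).neg).sub (((h j 1).sub (h i 1)).mul (h i 0).neg)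
  · simp [orient_def, hij]

lemma eventually_residual_concurrency_ne {a b c d e f : V} (hn : [a, b, c, d, e, f].Nodup) :
    ∀ᶠ P : V → Plane in residual _,
      concurrency (P a) (P b) (P c) (P d) (P e) (P f) ≠ 0 := by
  classical
  have h := analyticOnNhd_coord (V := V)
  refine eventually_residual_ne_zero ?_
    -- The three lines are here `y = 0`, `y = 1` and `x = 0`; the first two are parallel and
    -- distinct.
    ⟨fun v => if v = b then !₂[1, 0] else if v = c then !₂[0, 1] else if v = d then !₂[1, 1]
      else if v = f then !₂[0, 1] else 0, ?_⟩
  · have h1 : ∀ i j : V, AnalyticOnNhd ℝ (fun P : V → Plane => cross (P i) (P j)) univ :=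
      fun i j => ((h i 0).mul (h j 1)).sub ((h i 1).mul (h j 0))
    have h2 : ∀ i j k l : V,
        AnalyticOnNhd ℝ (fun P : V → Plane => cross (P i - P j) (P k - P l)) univ :=
      fun i j k l => (((h i 0).sub (h j 0)).mul ((h k 1).sub (h l 1))).sub
        (((h i 1).sub (h j 1)).mul ((h k 0).sub (h l 0)))
    exact (((h1 a b).mul (h2 d c f e)).add ((h1 c d).mul (h2 f e b a))).add
      ((h1 e f).mul (h2 b a d c))
  · simp only [List.nodup_cons, List.mem_cons, List.not_mem_nil, or_false, not_or,
      List.nodup_nil, not_false_eq_true, and_true] at hn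
    obtain ⟨⟨hab, hac, had, hae, haf⟩, ⟨hbc, hbd, hbe, hbf⟩, ⟨hcd, hce, hcf⟩, ⟨hde, hdf⟩, hef⟩ := hn
    simp [concurrency, cross, hab, hac, had, haf, Ne.symm hbc, Ne.symm hbd, Ne.symm hbe,
      Ne.symm hbf, Ne.symm hcd, Ne.symm hce, Ne.symm hcf, Ne.symm hde, Ne.symm hdf, hef]

/-- Every nonempty open condition on finitely many points is met by points in general position. -/
lemma exists_generalPosition_of_eventually {p : (V → Plane) → Prop} {Q : V → Plane}
    (h : ∀ᶠ P in nhds Q, p P) : ∃ P, GeneralPosition P ∧ p P := by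
  have hr : ∀ᶠ P : V → Plane in residual _, GeneralPosition P := by
    have h1 : ∀ᶠ P : V → Plane in residual _, ∀ i j k, i ≠ j → i ≠ k → j ≠ k →
        orient (P i) (P j) (P k) ≠ 0 := by
      simp only [Filter.eventually_all]
      exact fun i j k hij hik hjk => eventually_residual_orient_ne hij hik hjk
    have h2 : ∀ᶠ P : V → Plane in residual _, ∀ i j, i ≠ j → orient (P i) (P j) 0 ≠ 0 := by
      simp only [Filter.eventually_all]
      exact fun i j hij => eventually_residual_orient_zero_ne hij
    have h3 : ∀ᶠ P : V → Plane in residual _, ∀ a b c d e f, [a, b, c, d, e, f].Nodup →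
        concurrency (P a) (P b) (P c) (P d) (P e) (P f) ≠ 0 := by
      simp only [Filter.eventually_all]
      exact fun a b c d e f hn => eventually_residual_concurrency_ne hn
    filter_upwards [h1, h2, h3] with P h1 h2 h3
    exact ⟨h1, h2, h3⟩
  -- By Baire's theorem a residual set of configurations is dense.
  obtain ⟨P, hP, hPp⟩ := (dense_of_mem_residual hr).inter_nhds_nonempty h
  exact ⟨P, hP, hPp⟩

omit [Fintype V] in
lemma eventually_subset_openTri {K : Set Plane} (hK : IsCompact K) {Q : V → Plane} {u v w : V}
    (h : K ⊆ openTri (Q u) (Q v) (Q w)) :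
    ∀ᶠ P in nhds Q, K ⊆ openTri (P u) (P v) (P w) := by
  have ho : IsOpen {z : (V → Plane) × Plane | z.2 ∈ openTri (z.1 u) (z.1 v) (z.1 w)} := by
    have aux : ∀ u v : V, IsOpen {z : (V → Plane) × Plane | 0 < orient (z.1 u) (z.1 v) z.2} :=
      fun u v => isOpen_lt continuous_const (by fun_prop)
    exact (aux u v).inter ((aux v w).inter (aux w u))
  exact hK.eventually_forall_of_forall_eventually fun x hx => ho.mem_nhds (h hx)

omit [Fintype V] in
lemma eventually_notMem_closedTri {x : Plane} {Q : V → Plane} {u v w : V}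
    (h : x ∉ closedTri (Q u) (Q v) (Q w)) :
    ∀ᶠ P in nhds Q, x ∉ closedTri (P u) (P v) (P w) := by
  have hc : IsClosed {P : V → Plane | x ∈ closedTri (P u) (P v) (P w)} := by
    have aux : ∀ u v : V, IsClosed {P : V → Plane | 0 ≤ orient (P u) (P v) x} :=
      fun u v => isClosed_le continuous_const (by fun_prop)
    exact (aux u v).inter ((aux v w).inter (aux w u))
  exact hc.isOpen_compl.mem_nhds h

end Generic

/-! ### The configuration -/

/-- A closed axis-parallel rectangle. -/
def closedBox (l r b t : ℝ) : Set Plane := {x | x 0 ∈ Icc l r ∧ x 1 ∈ Icc b t}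

/-- An open axis-parallel rectangle. -/
def openBox (l r b t : ℝ) : Set Plane := {x | x 0 ∈ Ioo l r ∧ x 1 ∈ Ioo b t}

lemma isCompact_closedBox (l r b t : ℝ) : IsCompact (closedBox l r b t) := by
  have h : closedBox l r b t = (fun p : ℝ × ℝ => !₂[p.1, p.2]) '' (Icc l r ×ˢ Icc b t) := by
    ext x
    constructor
    · exact fun hx => ⟨(x 0, x 1), hx, Plane.ext rfl rfl⟩
    · rintro ⟨p, hp, rfl⟩; exact hp
  rw [h]
  refine (isCompact_Icc.prod isCompact_Icc).image ((PiLp.continuous_toLp 2 _).comp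
    (continuous_pi fun i => ?_))
  fin_cases i <;> simp <;> fun_prop

lemma isOpen_openBox (l r b t : ℝ) : IsOpen (openBox l r b t) := by
  have h : ∀ c : Fin 2, Continuous fun x : Plane => x c := fun c => by fun_prop
  exact (isOpen_Ioo.preimage (h 0)).inter (isOpen_Ioo.preimage (h 1))

lemma convex_openBox (l r b t : ℝ) : Convex ℝ (openBox l r b t) := by
  have h : ∀ c : Fin 2, IsLinearMap ℝ fun x : Plane => x c :=
    fun c => (EuclideanSpace.proj (𝕜 := ℝ) c).toLinearMap.isLinear
  exact ((convex_Ioo l r).is_linear_preimage (h 0)).inter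
    ((convex_Ioo b t).is_linear_preimage (h 1))

/-- The vertices of a triangle containing the origin in its interior, sheared with slope `m`. -/
def shearedTriangle (m : ℝ) : Fin 3 → Plane :=
  ![!₂[-m, -1], !₂[2 + 2 * m, 2], !₂[-2 + 2 * m, 2]]

/-- The vertices of a flat triangle with a horizontal side of length `2 * k - 1`. -/
noncomputable def flatTriangle (k η : ℝ) : Fin 3 → Plane :=
  ![!₂[3 / 2, 1 + η / 4], !₂[2 * k + 1 / 2, 1 + η / 4], !₂[3 / 2, 1 + 3 * η / 4]]

/-- At height `y` the triangle is the interval centred at `m * y` with half-width `2 * (y + 1) / 3`.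
Shearing moves the section at height 1 to centre `m` while the origin stays inside. -/
lemma mem_openTri_shearedTriangle {m : ℝ} {x : Plane} :
    x ∈ openTri (shearedTriangle m 0) (shearedTriangle m 1) (shearedTriangle m 2) ↔
      0 < 2 * x 1 + 2 - 3 * (x 0 - m * x 1) ∧ x 1 < 2 ∧ 0 < 2 * x 1 + 2 + 3 * (x 0 - m * x 1) := by
  simp only [openTri, shearedTriangle, orient_def, mem_ofPred_eq, Matrix.cons_val]
  refine and_congr ?_ (and_congr ?_ ?_) <;> constructor <;> intro h <;> linarith

lemma mem_closedTri_shearedTriangle {m : ℝ} {x : Plane} :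
    x ∈ closedTri (shearedTriangle m 0) (shearedTriangle m 1) (shearedTriangle m 2) ↔
      0 ≤ 2 * x 1 + 2 - 3 * (x 0 - m * x 1) ∧ x 1 ≤ 2 ∧ 0 ≤ 2 * x 1 + 2 + 3 * (x 0 - m * x 1) := by
  simp only [closedTri, shearedTriangle, orient_def, mem_ofPred_eq, Matrix.cons_val]
  refine and_congr ?_ (and_congr ?_ ?_) <;> constructor <;> intro h <;> linarith

lemma zero_mem_openTri_shearedTriangle (m : ℝ) :
    (0 : Plane) ∈ openTri (shearedTriangle m 0) (shearedTriangle m 1) (shearedTriangle m 2) :=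
  mem_openTri_shearedTriangle.2 (by simp)

/-- Between heights `1` and `1 + η` the centre drifts from `m` by at most `1 / 4`, while the
half-width is at least `4 / 3 > 1 + 1 / 4`. -/
lemma closedBox_subset_openTri_shearedTriangle {m η : ℝ} (hm : 0 ≤ m) (h : m * η ≤ 1 / 4)
    (hη : η < 1) : closedBox (m - 1) (m + 1) 1 (1 + η) ⊆
      openTri (shearedTriangle m 0) (shearedTriangle m 1) (shearedTriangle m 2) := by
  rintro x ⟨⟨h1, h2⟩, h3, h4⟩
  have h5 : 0 ≤ m * (x 1 - 1) := mul_nonneg hm (by linarith)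
  have h6 : m * (x 1 - 1) ≤ m * η := mul_le_mul_of_nonneg_left (by linarith) hm
  refine mem_openTri_shearedTriangle.2 ⟨?_, ?_, ?_⟩ <;> linarith

/-- The half-width is at most `17 / 12` at these heights, less than the remaining distance `2 - 1 /
4` from the centre. -/
lemma notMem_closedTri_shearedTriangle {m l y η : ℝ} (hm : 0 ≤ m) (h : m * η ≤ 1 / 4)
    (hη : η ≤ 1 / 8) (hy : 1 ≤ y) (hy' : y ≤ 1 + η) (hl : l ≤ m - 2 ∨ m + 2 ≤ l) :
    !₂[l, y] ∉ closedTri (shearedTriangle m 0) (shearedTriangle m 1) (shearedTriangle m 2) := by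
  rw [mem_closedTri_shearedTriangle]
  rintro ⟨h1, -, h3⟩
  simp only [Matrix.cons_val] at h1 h3
  have h5 : 0 ≤ m * (y - 1) := mul_nonneg hm (by linarith)
  have h6 : m * (y - 1) ≤ m * η := mul_le_mul_of_nonneg_left (by linarith) hm
  rcases hl with hl | hl <;> linarith

/-- The critical case is `l = 2 * k`, where the sloping side is still `η / (4 * (2 * k - 1))` above
the base, more than `η / (16 * k)`. One height thus works for all witnesses. -/
lemma mem_openTri_flatTriangle {k η l : ℝ} (hk : 1 ≤ k) (hη : 0 < η) (hl : 2 ≤ l)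
    (hl' : l ≤ 2 * k) : !₂[l, 1 + η / 4 + η / (16 * k)] ∈
      openTri (flatTriangle k η 0) (flatTriangle k η 1) (flatTriangle k η 2) := by
  obtain ⟨s, hs, hs0⟩ : ∃ s, s = η / (16 * k) ∧ 0 < s := ⟨_, rfl, by positivity⟩
  have hsk : 16 * (k * s) = η := by rw [hs]; field_simp
  rw [← hs]
  simp only [openTri, flatTriangle, orient_def, mem_ofPred_eq, Matrix.cons_val]
  refine ⟨?_, ?_, ?_⟩
  · nlinarith
  · nlinarith [mul_nonneg hη.le (sub_nonneg.2 hl')]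
  · nlinarith

lemma flatTriangle_mem_openBox {k η : ℝ} (hk : 1 ≤ k) (hη : 0 < η) (c : Fin 3) :
    flatTriangle k η c ∈ openBox 1 (2 * k + 1) 1 (1 + η) := by
  fin_cases c <;>
    simp only [openBox, flatTriangle, mem_ofPred_eq, Fin.reduceFinMk, Fin.zero_eta, Fin.mk_one,
      Matrix.cons_val, mem_Ioo] <;>
    refine ⟨⟨?_, ?_⟩, ?_, ?_⟩ <;> linarith

/-- The boxes have width 2 and are centred at the even integers `2, ..., 2 * k`, so rounding `x 0 /
2` to a nearest integer gives the index. -/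
lemma openBox_subset_iUnion_closedBox (k : ℕ) (η : ℝ) {x : Plane}
    (hx : x ∈ openBox 1 (2 * k + 1) 1 (1 + η)) :
    ∃ i : Fin (k + 1), i ≠ 0 ∧ x ∈ closedBox (2 * (i : ℕ) - 1) (2 * (i : ℕ) + 1) 1 (1 + η) := by
  obtain ⟨⟨h1, h2⟩, h3⟩ := hx
  have hpos : 0 ≤ (x 0 + 1) / 2 := by linarith
  have hf1 := Nat.floor_le hpos
  have hf2 := Nat.lt_floor_add_one ((x 0 + 1) / 2)
  have hlt : ⌊(x 0 + 1) / 2⌋₊ < k + 1 := by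
    rw [Nat.floor_lt hpos]; push_cast; linarith
  have hge : 1 ≤ ⌊(x 0 + 1) / 2⌋₊ := by
    rw [Nat.le_floor_iff hpos]; push_cast; linarith
  refine ⟨⟨_, hlt⟩, ?_, ⟨?_, ?_⟩, h3.1.le, h3.2.le⟩
  · rw [Ne, Fin.ext_iff]; exact Nat.one_le_iff_ne_zero.1 hge
  · change 2 * ((⌊(x 0 + 1) / 2⌋₊ : ℕ) : ℝ) - 1 ≤ x 0; linarith
  · change x 0 ≤ 2 * ((⌊(x 0 + 1) / 2⌋₊ : ℕ) : ℝ) + 1; linarith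

/-- The vertices of the `i`-th special triangle. -/
def specialVertex {n : ℕ} (i : Fin n) (c : Fin 3) : Fin (3 * n) := finProdFinEquiv (c, i)

/-- The inside of the `i`-th special triangle. -/
def specialOpenTri {n : ℕ} (P : Fin (3 * n) → Plane) (i : Fin n) : Set Plane :=
  openTri (P (specialVertex i 0)) (P (specialVertex i 1)) (P (specialVertex i 2))

/-- The `i`-th special triangle with its inside. -/
def specialClosedTri {n : ℕ} (P : Fin (3 * n) → Plane) (i : Fin n) : Set Plane :=
  closedTri (P (specialVertex i 0)) (P (specialVertex i 1)) (P (specialVertex i 2))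

/-- There are points in general position such that the triangle with index `0` does not contain the
origin, the others do, and the others cover the triangle with index `0` irredundantly. -/
lemma exists_configuration (k : ℕ) (hk : 1 ≤ k) :
    ∃ P : Fin (3 * (k + 1)) → Plane, GeneralPosition P ∧
      (0 : Plane) ∉ specialClosedTri P 0 ∧
      (∀ i, i ≠ 0 → (0 : Plane) ∈ specialOpenTri P i) ∧
      (∀ x ∈ specialClosedTri P 0, ∃ i, i ≠ 0 ∧ x ∈ specialOpenTri P i) ∧
      ∀ i, i ≠ 0 → ∃ w ∈ specialOpenTri P 0, ∀ j, j ≠ 0 → j ≠ i → w ∉ specialClosedTri P j := by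
  have hk' : (1 : ℝ) ≤ k := by exact_mod_cast hk
  -- The slopes `2 * i` are at most `2 * k`, so this height bounds the horizontal drift of every
  -- sheared triangle by `1 / 4`.
  obtain ⟨η, hη⟩ : ∃ η : ℝ, η = 1 / (8 * k) := ⟨_, rfl⟩
  have hηk : 8 * (k * η) = 1 := by rw [hη]; field_simp
  have hη0 : 0 < η := by rw [hη]; positivity
  have hη1 : η ≤ 1 / 8 := by nlinarith
  have hm0 : ∀ i : Fin (k + 1), (0 : ℝ) ≤ 2 * (i : ℕ) := fun i => by positivity
  have hmη : ∀ i : Fin (k + 1), 2 * ((i : ℕ) : ℝ) * η ≤ 1 / 4 := fun i => by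
    have : ((i : ℕ) : ℝ) ≤ k := by exact_mod_cast Nat.lt_succ_iff.1 i.2
    nlinarith
  let B : Fin (k + 1) → Fin 3 → Plane := fun i =>
    if i = 0 then flatTriangle k η else shearedTriangle (2 * (i : ℕ))
  let Q : Fin (3 * (k + 1)) → Plane := fun v => B (finProdFinEquiv.symm v).2 (finProdFinEquiv.symm v).1
  have hQ : ∀ i c, Q (specialVertex i c) = B i c := fun i c => by
    simp only [Q, specialVertex, Equiv.symm_apply_apply]
  have hB0 : B 0 = flatTriangle k η := if_pos rfl
  have hB : ∀ i, i ≠ 0 → B i = shearedTriangle (2 * (i : ℕ)) := fun i hi => if_neg hi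
  -- The witness `w i` sits at the centre of the `i`-th box, at distance at least 2 from the centres
  -- of the others.
  let w : Fin (k + 1) → Plane := fun i => !₂[2 * (i : ℕ), 1 + η / 4 + η / (16 * k)]
  -- Each of `e1` to `e4` is an open condition that holds at `Q`, so it survives the perturbation
  -- into general position. The fixed boxes mediate the covering: the perturbed flat triangle stays
  -- inside their union, and each box stays inside its perturbed triangle.
  have e1 : ∀ᶠ P in nhds Q, ∀ i : Fin (k + 1), i ≠ 0 →
      insert 0 (closedBox (2 * (i : ℕ) - 1) (2 * (i : ℕ) + 1) 1 (1 + η)) ⊆ specialOpenTri P i := by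
    simp only [Filter.eventually_all]
    intro i hi
    refine eventually_subset_openTri ((isCompact_closedBox _ _ _ _).insert 0) ?_
    rw [hQ, hQ, hQ, hB i hi]
    exact insert_subset (zero_mem_openTri_shearedTriangle _)
      (closedBox_subset_openTri_shearedTriangle (hm0 i) (hmη i) (by linarith))
  have e2 : ∀ᶠ P in nhds Q, ∀ c, P (specialVertex 0 c) ∈ openBox 1 (2 * k + 1) 1 (1 + η) := by
    simp only [Filter.eventually_all]
    intro c
    refine (continuous_apply (specialVertex 0 c)).continuousAt.eventually_mem
      ((isOpen_openBox _ _ _ _).mem_nhds ?_)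
    rw [hQ, hB0]
    exact flatTriangle_mem_openBox hk' hη0 c
  have e3 : ∀ᶠ P in nhds Q, ∀ i, i ≠ 0 → {w i} ⊆ specialOpenTri P 0 := by
    simp only [Filter.eventually_all]
    intro i hi
    refine eventually_subset_openTri isCompact_singleton ?_
    rw [hQ, hQ, hQ, hB0, singleton_subset_iff]
    have h1 : 1 ≤ (i : ℕ) := Nat.one_le_iff_ne_zero.2 fun h => hi (Fin.ext h)
    have h2 : (i : ℕ) ≤ k := Nat.lt_succ_iff.1 i.2
    have h1' : (1 : ℝ) ≤ (i : ℕ) := by exact_mod_cast h1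
    have h2' : ((i : ℕ) : ℝ) ≤ k := by exact_mod_cast h2
    exact mem_openTri_flatTriangle hk' hη0 (by linarith) (by linarith)
  have e4 : ∀ᶠ P in nhds Q, ∀ i j, j ≠ 0 → j ≠ i → w i ∉ specialClosedTri P j := by
    simp only [Filter.eventually_all]
    intro i j hj hji
    refine eventually_notMem_closedTri ?_
    rw [hQ, hQ, hQ, hB j hj]
    have hs : η / (16 * k) ≤ η / 2 := by
      apply div_le_div_of_nonneg_left hη0.le <;> linarith
    have hs0 : 0 ≤ η / (16 * k) := by positivity
    refine notMem_closedTri_shearedTriangle (hm0 j) (hmη j) hη1 (by linarith) (by linarith) ?_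
    rcases lt_or_gt_of_ne hji with h | h
    · right
      have : ((j : ℕ) : ℝ) + 1 ≤ (i : ℕ) := by exact_mod_cast h
      linarith
    · left
      have : ((i : ℕ) : ℝ) + 1 ≤ (j : ℕ) := by exact_mod_cast h
      linarith
  obtain ⟨P, hP, ⟨⟨p1, p2⟩, p3⟩, p4⟩ :=
    exists_generalPosition_of_eventually (((e1.and e2).and e3).and e4)
  have hone : (1 : Fin (k + 1)) ≠ 0 := by
    rw [Ne, Fin.ext_iff, Fin.val_one', Nat.mod_eq_of_lt (by omega)]; simp
  have hbox : specialClosedTri P 0 ⊆ openBox 1 (2 * k + 1) 1 (1 + η) := by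
    obtain ⟨h1, h2, h3⟩ := p3 1 hone (mem_singleton _)
    -- The point `w 1` is inside the perturbed triangle, and the orientation is the sum of the three
    -- positive ones at that point.
    have hor : 0 < orient (P (specialVertex 0 0)) (P (specialVertex 0 1)) (P (specialVertex 0 2)) := by
      rw [← orient_add_orient_add_orient _ _ _ (w 1)]; linarith
    refine (closedTri_subset_convexHull hor).trans (convexHull_min ?_ (convex_openBox _ _ _ _))
    rintro y (rfl | rfl | rfl)
    exacts [p2 0, p2 1, p2 2]
  refine ⟨P, hP, fun h => ?_, fun i hi => p1 i hi (mem_insert _ _), fun x hx => ?_, fun i hi =>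
    ⟨w i, p3 i hi (mem_singleton _), p4 i⟩⟩
  · have := (hbox h).1.1
    rw [PiLp.zero_apply] at this
    linarith
  · obtain ⟨i, hi, hxi⟩ := openBox_subset_iUnion_closedBox k η (hbox hx)
    exact ⟨i, hi, p1 i hi (mem_insert_of_mem _ hxi)⟩

/-! ### The drawing -/

lemma orient_pos_of_mem_openTri {a b c x : Plane} (h : x ∈ openTri a b c) : 0 < orient a b c := by
  rw [← orient_add_orient_add_orient a b c x]
  linarith [h.1, h.2.1, h.2.2]

/-- The vertex set of the `i`-th special triangle. -/
def specialTriple {n : ℕ} (i : Fin n) : Finset (Fin (3 * n)) :=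
  Finset.univ.image (specialVertex i)

lemma specialVertex_inj {n : ℕ} {i j : Fin n} {c d : Fin 3} :
    specialVertex i c = specialVertex j d ↔ c = d ∧ i = j := by
  rw [specialVertex, specialVertex, finProdFinEquiv.injective.eq_iff, Prod.mk.injEq]

lemma card_specialTriple {n : ℕ} (i : Fin n) : (specialTriple i).card = 3 := by
  rw [specialTriple, Finset.card_image_of_injective _ fun _ _ h => (specialVertex_inj.1 h).1,
    Finset.card_univ, Fintype.card_fin]

lemma mem_specialTriple {n : ℕ} {i : Fin n} (v : Fin (3 * n)) :
    v ∈ specialTriple i ↔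
      v = specialVertex i 0 ∨ v = specialVertex i 1 ∨ v = specialVertex i 2 := by
  simp [specialTriple, Fin.exists_fin_succ, eq_comm]

lemma specialTriple_injective {n : ℕ} : Function.Injective (specialTriple (n := n)) := by
  intro i j h
  have : specialVertex i 0 ∈ specialTriple j := h ▸ (mem_specialTriple _).2 (Or.inl rfl)
  rcases (mem_specialTriple _).1 this with h | h | h <;> exact (specialVertex_inj.1 h).2

lemma exists_faceConvex_drawing (k : ℕ) (hk : 1 ≤ k) :
    ∃ D : TopologicalDrawing (Fin (3 * (k + 1))), D.IsFaceConvex ∧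
      (∃ (D₀ : TopologicalDrawing (Fin (3 * (k + 1)))) (f₀ : Set Plane),
        D₀.IsStraightLine ∧ D₀.IsFace f₀ ∧ D.IsObtainedByMakingOuter D₀ f₀) ∧
      (∀ i : Fin (k + 1), ∃ p : Plane, ∀ j, j ≠ i →
        p ∈ interior (D.boundedSide (specialTriple j))) ∧
      (⋂ i : Fin (k + 1), D.boundedSide (specialTriple i)) = ∅ := by
  obtain ⟨P, hP, h0, h1, hcov, hirr⟩ := exists_configuration k hk
  have : Nontrivial (Fin (3 * (k + 1))) := Fin.nontrivial_iff_two_le.2 (by omega)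
  have hone : (1 : Fin (k + 1)) ≠ 0 := by
    rw [Ne, Fin.ext_iff, Fin.val_one', Nat.mod_eq_of_lt (by omega)]; simp
  have hor0 : 0 < orient (P (specialVertex 0 0)) (P (specialVertex 0 1)) (P (specialVertex 0 2)) := by
    obtain ⟨w, hw, -⟩ := hirr 1 hone
    exact orient_pos_of_mem_openTri hw
  have hs0 := hP.boundedSide_of_zero_notMem hor0 mem_specialTriple h0
  have hor : ∀ i : Fin (k + 1), i ≠ 0 →
      0 < orient (P (specialVertex i 0)) (P (specialVertex i 1)) (P (specialVertex i 2)) :=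
    fun i hi => orient_pos_of_mem_openTri (h1 i hi)
  have hs1 := fun i (hi : i ≠ 0) =>
    hP.boundedSide_of_zero_mem (hor i hi) mem_specialTriple (h1 i hi)
  refine ⟨hP.invertedDrawing, hP.isFaceConvex_invertedDrawing,
    ⟨hP.drawing, _, hP.isStraightLine_drawing, ⟨0, hP.zero_notMem_support, rfl⟩,
      hP.drawing.isObtainedByMakingOuter_inverted _⟩, fun i => ?_, ?_⟩
  · by_cases hi : i = 0
    -- With the flat triangle dropped, the origin works: it is the image of infinity, which is
    -- outside every triangle.
    · refine ⟨0, fun j hj => ?_⟩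
      rw [hi] at hj
      rw [hs1 j hj]
      exact interior_maximal subset_closure (isOpen_outerSide (hor j hj)) (Or.inl rfl)
    -- With a covering triangle dropped, the image of its private point of the flat triangle works.
    · obtain ⟨w, hw, hw'⟩ := hirr i hi
      have hw0 : w ≠ 0 := fun h => h0 (h ▸ openTri_subset_closedTri _ _ _ hw)
      refine ⟨planeInv w, fun j hj => ?_⟩
      by_cases hj0 : j = 0
      · rw [hj0, hs0]
        refine interior_maximal subset_closure (isOpen_innerSide _ _ _)
          ⟨mt planeInv_eq_zero.1 hw0, ?_⟩
        rwa [planeInv_planeInv]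
      · rw [hs1 j hj0]
        refine interior_maximal subset_closure (isOpen_outerSide (hor j hj0)) (Or.inr ?_)
        rw [planeInv_planeInv]
        exact hw' j hj0 hj
  · refine eq_empty_of_forall_notMem fun x hx => ?_
    rw [mem_iInter] at hx
    have hx0 := hx 0
    rw [hs0] at hx0
    obtain ⟨hne, hmem⟩ := closure_innerSide_subset hor0 hx0
    -- The preimage lies in the flat triangle, hence in some open covering triangle; its image is
    -- then in the open set `innerSide`, which misses the closure of `outerSide`.
    obtain ⟨i, hi, hxi⟩ := hcov _ hmem
    have hxi' := hx i
    rw [hs1 i hi] at hxi'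
    exact ((disjoint_innerSide_outerSide _ _ _).closure_right
      (isOpen_innerSide _ _ _)).notMem_of_mem_left ⟨hne, hxi⟩ hxi'

/-! ### Helly numbers and the conclusion. -/

/-- A subfamily omitting some index has a common point, so only the full family can have empty
intersection. -/
lemma le_hellyNumber {n : ℕ} {X : Type} {S : Fin n → Set X}
    (h : ∀ i, ∃ p, ∀ j, j ≠ i → p ∈ S j) : (n : ℕ∞) ≤ hellyNumber S := by
  refine le_iInf₂ fun s hs => ?_
  have huniv : s = Finset.univ := by
    refine Finset.eq_univ_iff_forall.2 fun i => ?_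
    by_contra hi
    obtain ⟨p, hp⟩ := h i
    refine eq_empty_iff_forall_notMem.1 hs p (mem_iInter₂.2 fun j hj => hp j ?_)
    rintro rfl
    exact hi hj
  rw [huniv, Finset.card_univ, Fintype.card_fin]

theorem proposition3 :
    -- Helly's theorem (in the plane) does not generalize to face-convex drawings
    (¬ ∀ (m : ℕ) (D : TopologicalDrawing (Fin m)), D.IsFaceConvex →
      ∀ T : Finset (Finset (Fin m)), (∀ t ∈ T, t.card = 3) →
        (∀ S ⊆ T, S.card ≤ 3 → (⋂ t ∈ S, D.boundedSide t).Nonempty) →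
          (⋂ t ∈ T, D.boundedSide t).Nonempty) ∧
    -- and Helly numbers of face-convex drawings are unbounded
    ∀ n : ℕ, 3 ≤ n →
      ∃ D : TopologicalDrawing (Fin (3 * n)), D.IsFaceConvex ∧
        (∃ (D₀ : TopologicalDrawing (Fin (3 * n))) (f₀ : Set Plane),
          D₀.IsStraightLine ∧ D₀.IsFace f₀ ∧ D.IsObtainedByMakingOuter D₀ f₀) ∧
        ∃ T : Fin n → Finset (Fin (3 * n)),
          Function.Injective T ∧ (∀ i, (T i).card = 3) ∧
          (∀ s : Finset (Fin n), s.card = n - 1 →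
            ∃ p : Plane, ∀ i ∈ s, p ∈ interior (D.boundedSide (T i))) ∧
          (⋂ i, D.boundedSide (T i)) = ∅ ∧
          (n : ℕ∞) ≤ hellyNumber (fun i => D.boundedSide (T i)) := by
  constructor
  · intro H
    -- Here `k = 3` gives four triangles, the least number for which any three bounded sides still
    -- meet while all of them do not.
    obtain ⟨D, hD, -, hp, he⟩ := exists_faceConvex_drawing 3 (by norm_num)
    obtain ⟨x, hx⟩ := H _ D hD (Finset.univ.image specialTriple)
      (fun t ht => by
        obtain ⟨i, -, rfl⟩ := Finset.mem_image.1 ht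
        exact card_specialTriple i)
      (fun S hS hcard => by
        obtain ⟨i, hi⟩ : ∃ i : Fin (3 + 1), specialTriple i ∉ S := by
          by_contra! hall
          have hle := Finset.card_le_card (s := Finset.univ.image (specialTriple (n := 3 + 1)))
            (t := S) fun t ht => by
              obtain ⟨i, -, rfl⟩ := Finset.mem_image.1 ht
              exact hall i
          rw [Finset.card_image_of_injective _ specialTriple_injective, Finset.card_univ,
            Fintype.card_fin] at hle
          omega
        obtain ⟨p, hp⟩ := hp i
        refine ⟨p, mem_iInter₂.2 fun t ht => ?_⟩
        obtain ⟨j, -, rfl⟩ := Finset.mem_image.1 (hS ht)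
        refine interior_subset (hp j ?_)
        rintro rfl
        exact hi ht)
    refine eq_empty_iff_forall_notMem.1 he x (mem_iInter.2 fun i => ?_)
    exact mem_iInter₂.1 hx _ (Finset.mem_image_of_mem _ (Finset.mem_univ i))
  · intro n hn
    obtain ⟨k, rfl⟩ : ∃ k, n = k + 1 := ⟨n - 1, by omega⟩
    obtain ⟨D, hD, hD₀, hp, he⟩ := exists_faceConvex_drawing k (by omega)
    refine ⟨D, hD, hD₀, specialTriple, specialTriple_injective, card_specialTriple,
      fun s hs => ?_, he, le_hellyNumber fun i => ?_⟩
    · obtain ⟨i, hi⟩ : ∃ i, i ∉ s := by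
        by_contra! hall
        rw [Finset.eq_univ_iff_forall.2 hall, Finset.card_univ, Fintype.card_fin] at hs
        omega
      obtain ⟨p, hp⟩ := hp i
      exact ⟨p, fun j hj => hp j fun h => hi (h ▸ hj)⟩
    · obtain ⟨p, hp⟩ := hp i
      exact ⟨p, fun j hj => interior_subset (hp j hj)⟩
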